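/- **Setting.** Let $\mathcal A$ be a Hopf $*$-algebra over $\mathbb C$ with comultiplication $\Delta$ that admits a (positive) Haar integral $h$: a linear functional with $h(1)=1$, $h(a^*a)\ge 0$ and $(\mathrm{id}\otimes h)\Delta(a)=(h\otimes\mathrm{id})\Delta(a)=h(a)1$ for all $a\in\mathcal A$. (The Hopf $*$-algebra associated to a compact quantum group has this property.) Let $(\Omega,d)$ be a $*$-differential calculus over $\mathcal A$. That is, $\Omega=\bigoplus_{k\ge0}\Omega_k$ is a graded complex algebra with a conjugate-linear involution of degree $0$ satisfying $(\omega\eta)^*=(-1)^{kl}\eta^*\omega^*$ for $\omega\in\Omega_k$, $\eta\in\Omega_l$; $d$ is a linear map of degree $1$ with $d^2=0$, $d1=0$, $d(\omega^*)=(d\omega)^*$ and $d(\omega\eta)=(d\omega)\eta+(-1)^k\omega\,d\eta$ for $\omega\in\Omega_k$, $\eta\in\Omega$; $\Omega_0=\mathcal A$ as $*$-algebras; for $k>0$, $\Omega_k$ is the linear span of the products $a_0\,da_1\cdots da_k$ with $a_j\in\mathcal A$; and there is an algebra homomorphism $\Delta_\Omega:\Omega\to\mathcal A\otimes\Omega$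 extending $\Delta$ with $(\mathrm{id}\otimes d)\Delta_\Omega=\Delta_\Omega d$. Put $\Omega^{\mathrm{inv}}=\{\omega:\Delta_\Omega(\omega)=1\otimes\omega\}$ and $\Omega^{\mathrm{inv}}_k=\Omega_k\cap\Omega^{\mathrm{inv}}$. Assume that $\Omega^{\mathrm{inv}}$ is finite-dimensional; that $\Omega$ has dimension $N$, i.e. $\Omega_N\ne0$ and $\Omega_k=0$ for $k>N$; that $\dim\Omega^{\mathrm{inv}}_N=1$; that $d(\Omega^{\mathrm{inv}}_{N-1})=0$ (no condition if $N=0$); and that $\Omega$ is non-degenerate, i.e. if $0\le k\le N$, $\omega\in\Omega_k$ and $\omega'\omega=0$ for all $\omega'\in\Omega_{N-k}$, then $\omega=0$. Let $\langle\cdot,\cdot\rangle$ be an inner product on $\Omega$ (linear in the first variable) that is graded (forms of different degrees are orthogonal) and left-invariant ($\langle a\omega,b\eta\rangle=h(b^*a)\langle\omega,\eta\rangle$ for $a,b\in\mathcal A$, $\omega,\eta\in\Omega^{\mathrm{inv}}$). Let $\theta\in\Omega^{\mathrm{inv}}_N$ be a volume element: $\theta^*=\theta$ and $\langle\theta,\theta\rangle=1$.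 **Associated objects.** The following exist and are unique: * the integral $\int:\Omega\to\mathbb C$, the linear functional that vanishes on $\Omega_k$ for $k<N$ and has $\int a\theta=h(a)$ for $a\in\mathcal A$; * the twist automorphism $\sigma$ of $\int$, the algebra automorphism of $\Omega$ of degree $0$ with $\sigma d=d\sigma$ and $\int\omega'\omega=(-1)^{kl}\int\sigma(\omega)\omega'$ for $\omega\in\Omega_k$, $\omega'\in\Omega_l$; * the adjoint $d^*$ of $d$, the linear map with $\langle d\omega,\eta\rangle=\langle\omega,d^*\eta\rangle$ for all $\omega,\eta\in\Omega$; * the Hodge operator $L$, the left $\mathcal A$-linear operator on $\Omega$ with $L(\Omega_k)=\Omega_{N-k}$ for $0\le k\le N$ and $\int\omega^*L(\omega')=\langle\omega',\omega\rangle$ for all $\omega,\omega'\in\Omega$. Put $D=d+d^*$ and $\nabla=(d+d^*)^2$. **Theorem.** Suppose that $\sigma$ is positive, i.e. $\langle\sigma(\omega),\omega\rangle\ge0$ for all $\omega\in\Omega$. Then there is a unique exponential one-parameter group $\beta$ on $\Omega$ with $\beta_i=\sigma$. Here an exponential one-parameter group is a map $z\mapsto\beta_z$ from $\mathbb C$ to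 the algebra automorphisms of $\Omega$ with $\beta_{y+z}=\beta_y\beta_z$ and $\beta_z(\omega)^*=\beta_{\bar z}(\omega^*)$ such that, for each $\omega\in\Omega$, $\beta_z(\omega)$ is a finite sum $\sum_jf_j(z)v_j$ with $v_j\in\Omega$ and $f_j$ entire with $|f_j(z)|\le M_je^{r_j|\operatorname{Im}z|}$ for all $z$, for some $M_j,r_j>0$. Moreover: 1. $\langle\beta_z(\omega),\omega\rangle\ge0$ for all $\omega\in\Omega$ and $z\in\mathbb Ri$; 2. $\langle\beta_z(\omega),\eta\rangle=\langle\omega,\beta_{-\bar z}(\eta)\rangle$ for all $\omega,\eta\in\Omega$ and $z\in\mathbb C$; 3. $d^*\beta_z=\beta_zd^*$, $D\beta_z=\beta_zD$ and $\nabla\beta_z=\beta_z\nabla$ for all $z\in\mathbb C$; 4. $L\beta_z=\beta_zL$ for all $z\in\mathbb C$. -/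

import Mathlib

open scoped TensorProduct ComplexOrder ComplexConjugate

/-- A Hopf `*`-algebra over `ℂ`: a complex Hopf algebra that is also a unital `*`-algebra and
whose comultiplication is `*`-preserving (with `(a ⊗ b)^* = a^* ⊗ b^*`). -/
class HopfStarAlgebra (A : Type*) [Ring A] [HopfAlgebra ℂ A] [StarRing A] [StarModule ℂ A] :
    Prop where
  comul_star : ∀ a : A, Coalgebra.comul (R := ℂ) (star a) = star (Coalgebra.comul (R := ℂ) a)

/-- A (positive) Haar integral: a unital positive linear functional `h` with
`(id ⊗ h) Δ(a) = (h ⊗ id) Δ(a) = h(a) 1`. -/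
structure IsHaarIntegral {A : Type*} [Ring A] [HopfAlgebra ℂ A] [StarRing A]
    (h : A →ₗ[ℂ] ℂ) : Prop where
  map_one : h 1 = 1
  right_inv : ∀ a : A,
    TensorProduct.rid ℂ A (TensorProduct.map LinearMap.id h (Coalgebra.comul a)) = h a • (1 : A)
  left_inv : ∀ a : A,
    TensorProduct.lid ℂ A (TensorProduct.map h LinearMap.id (Coalgebra.comul a)) = h a • (1 : A)
  nonneg : ∀ a : A, 0 ≤ h (star a * a)

/-- A (left-covariant) `*`-differential calculus `(Ω, d)` over the Hopf `*`-algebra `A`.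
The conjugate-linear involution of `Ω` is the ambient `star` (it is only graded
anti-multiplicative, so `Ω` is not a `StarRing`), and the `*`-algebra `A` is identified with the
`0`-forms through the injective homomorphism `ι`. -/
structure StarDifferentialCalculus (A Ω : Type*) [Ring A] [HopfAlgebra ℂ A] [StarRing A]
    [Ring Ω] [Algebra ℂ Ω] [StarAddMonoid Ω] where
  /-- The space `Ω_k` of `k`-forms. -/
  form : ℕ → Submodule ℂ Ω
  isInternal : DirectSum.IsInternal form
  mul_mem : ∀ (k l : ℕ) (ω η : Ω), ω ∈ form k → η ∈ form l → ω * η ∈ form (k + l)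
  star_mem : ∀ (k : ℕ) (ω : Ω), ω ∈ form k → star ω ∈ form k
  star_mul : ∀ (k l : ℕ) (ω η : Ω), ω ∈ form k → η ∈ form l →
    star (ω * η) = (-1 : ℂ) ^ (k * l) • (star η * star ω)
  /-- The differential. -/
  d : Ω →ₗ[ℂ] Ω
  d_mem : ∀ (k : ℕ) (ω : Ω), ω ∈ form k → d ω ∈ form (k + 1)
  d_star : ∀ ω : Ω, d (star ω) = star (d ω)
  d_mul : ∀ (k : ℕ) (ω η : Ω), ω ∈ form k →
    d (ω * η) = d ω * η + (-1 : ℂ) ^ k • (ω * d η)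
  d_d : ∀ ω : Ω, d (d ω) = 0
  d_one : d 1 = 0
  /-- The inclusion of `A` in `Ω`. -/
  ι : A →ₐ[ℂ] Ω
  ι_injective : Function.Injective ι
  ι_star : ∀ a : A, ι (star a) = star (ι a)
  ι_range : LinearMap.range ι.toLinearMap = form 0
  form_eq_span : ∀ k : ℕ, 0 < k → form k =
    Submodule.span ℂ {ω : Ω | ∃ (a₀ : A) (a : Fin k → A),
      ω = ι a₀ * (List.ofFn fun j => d (ι (a j))).prod}
  /-- The left coaction `Δ_Ω`. -/
  coact : Ω →ₐ[ℂ] A ⊗[ℂ] Ω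
  coact_ι : ∀ a : A,
    coact (ι a) = TensorProduct.map LinearMap.id ι.toLinearMap (Coalgebra.comul (R := ℂ) a)
  coact_d : ∀ ω : Ω, coact (d ω) = TensorProduct.map LinearMap.id d (coact ω)

/-- The inner product in the order `⟨ω, η⟩` that is linear in `ω` and conjugate-linear in `η`
(Mathlib's inner products are conjugate-linear in the first variable). -/
def ipForm {Ω : Type*} [AddCommGroup Ω] [Module ℂ Ω] (ip : InnerProductSpace.Core ℂ Ω)
    (ω η : Ω) : ℂ :=
  ip.inner η ω

/-- `S` is an adjoint of `T` with respect to the given inner product. -/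
def IsAdjointFor {Ω : Type*} [AddCommGroup Ω] [Module ℂ Ω] (ip : InnerProductSpace.Core ℂ Ω)
    (T S : Ω →ₗ[ℂ] Ω) : Prop :=
  ∀ ω η : Ω, ipForm ip (T ω) η = ipForm ip ω (S η)

namespace StarDifferentialCalculus

variable {A Ω : Type*} [Ring A] [HopfAlgebra ℂ A] [StarRing A]
  [Ring Ω] [Algebra ℂ Ω] [StarAddMonoid Ω]

/-- The space of left-invariant forms, `Δ_Ω(ω) = 1 ⊗ ω`. -/
def inv (Γ : StarDifferentialCalculus A Ω) : Submodule ℂ Ω :=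
  LinearMap.eqLocus Γ.coact.toLinearMap (TensorProduct.mk ℂ A Ω 1)

/-- The space of left-invariant `k`-forms. -/
def invForm (Γ : StarDifferentialCalculus A Ω) (k : ℕ) : Submodule ℂ Ω :=
  Γ.form k ⊓ Γ.inv

/-- The calculus has dimension `N`: there are nonzero `N`-forms, but no nonzero `k`-forms for
`k > N`. -/
def HasDimension (Γ : StarDifferentialCalculus A Ω) (N : ℕ) : Prop :=
  Γ.form N ≠ ⊥ ∧ ∀ k : ℕ, N < k → Γ.form k = ⊥

/-- Non-degeneracy of a calculus of dimension `N`. -/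
def Nondegenerate (Γ : StarDifferentialCalculus A Ω) (N : ℕ) : Prop :=
  ∀ (k : ℕ), k ≤ N → ∀ ω ∈ Γ.form k, (∀ ω' ∈ Γ.form (N - k), ω' * ω = 0) → ω = 0

/-- The inner product is graded: forms of different degrees are orthogonal. -/
def IsGraded (Γ : StarDifferentialCalculus A Ω) (ip : InnerProductSpace.Core ℂ Ω) : Prop :=
  ∀ (k l : ℕ), k ≠ l → ∀ ω ∈ Γ.form k, ∀ η ∈ Γ.form l, ipForm ip ω η = 0

/-- The inner product is left-invariant: `⟨aω, bη⟩ = h(b^* a) ⟨ω, η⟩` for invariant `ω`, `η`. -/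
def IsLeftInvariant (Γ : StarDifferentialCalculus A Ω) (h : A →ₗ[ℂ] ℂ)
    (ip : InnerProductSpace.Core ℂ Ω) : Prop :=
  ∀ (a b : A), ∀ ω ∈ Γ.inv, ∀ η ∈ Γ.inv,
    ipForm ip (Γ.ι a * ω) (Γ.ι b * η) = h (star b * a) * ipForm ip ω η

/-- A volume element: a self-adjoint invariant `N`-form of norm one. -/
def IsVolumeElement (Γ : StarDifferentialCalculus A Ω) (N : ℕ)
    (ip : InnerProductSpace.Core ℂ Ω) (θ : Ω) : Prop :=
  θ ∈ Γ.invForm N ∧ star θ = θ ∧ ipForm ip θ θ = 1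

/-- `J` is the integral associated to the volume element `θ`: it vanishes on `k`-forms with
`k < N`, and `∫ aθ = h(a)`. -/
def IsIntegral (Γ : StarDifferentialCalculus A Ω) (h : A →ₗ[ℂ] ℂ) (N : ℕ) (θ : Ω)
    (J : Ω →ₗ[ℂ] ℂ) : Prop :=
  (∀ k : ℕ, k < N → ∀ ω ∈ Γ.form k, J ω = 0) ∧ ∀ a : A, J (Γ.ι a * θ) = h a

/-- `σ` is a twist automorphism of `J`: an algebra automorphism of degree zero that commutes
with `d` and satisfies `∫ ω'ω = (-1)^{kl} ∫ σ(ω)ω'` for `ω ∈ Ω_k`, `ω' ∈ Ω_l`. -/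
structure IsTwistAutomorphism (Γ : StarDifferentialCalculus A Ω) (J : Ω →ₗ[ℂ] ℂ)
    (σ : Ω ≃ₐ[ℂ] Ω) : Prop where
  map_form : ∀ (k : ℕ), ∀ ω ∈ Γ.form k, σ ω ∈ Γ.form k
  comm_d : ∀ ω : Ω, σ (Γ.d ω) = Γ.d (σ ω)
  twist : ∀ (k l : ℕ), ∀ ω ∈ Γ.form k, ∀ ω' ∈ Γ.form l,
    J (ω' * ω) = (-1 : ℂ) ^ (k * l) * J (σ ω * ω')

/-- `L` is a Hodge operator: left `A`-linear, with `L(Ω_k) = Ω_{N-k}` for `0 ≤ k ≤ N` and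
`∫ ω^* L(ω') = ⟨ω', ω⟩`. -/
structure IsHodgeOperator (Γ : StarDifferentialCalculus A Ω) (N : ℕ)
    (ip : InnerProductSpace.Core ℂ Ω) (J : Ω →ₗ[ℂ] ℂ) (L : Ω →ₗ[ℂ] Ω) : Prop where
  map_smul : ∀ (a : A) (ω : Ω), L (Γ.ι a * ω) = Γ.ι a * L ω
  map_form : ∀ k : ℕ, k ≤ N → (Γ.form k).map L = Γ.form (N - k)
  integral : ∀ ω ω' : Ω, J (star ω * L ω') = ipForm ip ω' ω

/-- The Dirac operator `D = d + d^*`, where `ds` is the codifferential `d^*`. -/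
def dirac (Γ : StarDifferentialCalculus A Ω) (ds : Ω →ₗ[ℂ] Ω) : Ω →ₗ[ℂ] Ω :=
  Γ.d + ds

/-- The Laplacian `∇ = (d + d^*)^2`, where `ds` is the codifferential `d^*`. -/
def laplacian (Γ : StarDifferentialCalculus A Ω) (ds : Ω →ₗ[ℂ] Ω) : Ω →ₗ[ℂ] Ω :=
  Γ.dirac ds ∘ₗ Γ.dirac ds

end StarDifferentialCalculus

/-- An entire function `f` with `|f(z)| ≤ M e^{r |Im z|}` for some positive `M` and `r`. -/
def IsExponentialType (f : ℂ → ℂ) : Prop :=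
  Differentiable ℂ f ∧
    ∃ M r : ℝ, 0 < M ∧ 0 < r ∧ ∀ z : ℂ, ‖f z‖ ≤ M * Real.exp (r * |z.im|)

/-- A vector-valued function of finite exponential type: a finite sum `∑ f_j(z) v_j` with each
`f_j` of exponential type. -/
def IsFiniteExponentialType {V : Type*} [AddCommGroup V] [Module ℂ V] (F : ℂ → V) : Prop :=
  ∃ (n : ℕ) (v : Fin n → V) (f : Fin n → ℂ → ℂ),
    (∀ j, IsExponentialType (f j)) ∧ ∀ z : ℂ, F z = ∑ j, f j z • v j

/-- An exponential one-parameter group of algebra automorphisms of `Ω`. -/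
structure IsExponentialOneParameterGroup {Ω : Type*} [Ring Ω] [Algebra ℂ Ω] [StarAddMonoid Ω]
    (β : ℂ → (Ω ≃ₐ[ℂ] Ω)) : Prop where
  add : ∀ (y z : ℂ) (ω : Ω), β (y + z) ω = β y (β z ω)
  map_star : ∀ (z : ℂ) (ω : Ω), star (β z ω) = β (conj z) (star ω)
  exponential : ∀ ω : Ω, IsFiniteExponentialType fun z : ℂ => β z ω

/-! Once `σ` is known to be diagonalizable with positive eigenvalues, `β_z` must be the operator `r
^ (-iz)` on the `r`-eigenspace of `σ`. It is multiplicative because eigenvalues multiply under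
products. It is compatible with the involution because `σ(σ(ω)^*) = ω^*`, so that `*` exchanges the
eigenvalues `r` and `1/r`. For uniqueness, pair an orbit of an `r`-eigenvector with a linear
functional and multiply by `r ^ (iz)`: the result is `i`-periodic, entire and bounded on a strip,
hence constant by Liouville.

Since `Ω` is infinite-dimensional in general and not complete, diagonalizability needs more than
positivity: every form has to lie in a finite-dimensional `σ`-invariant subspace. The crucial
relation is `(S² ⊗ id) Δ_Ω σ = (id ⊗ σ) Δ_Ω`, with `S` the antipode
(`antipode_antipode_slice_twist`); it follows by applying strong left invariance of the integral
twice. Let `C` be the coefficient space of a finite-dimensional subcomodule. Unitarity of the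
coefficient matrix and invertibility of the Gram matrix of `⟨σ·,·⟩` give `C ⊆ S²(C)`
(`exists_antipode_antipode_eq`). As `S` is injective, the forms with coefficients in `C` are
`σ`-stable, and they lie in `C · Ω^inv`, which is finite-dimensional. The spectral theorem applies
there (`mem_span_eigenvectors`).

The remaining claims are formal. An operator commuting with `σ` preserves its eigenspaces, so it
commutes with `β`. This covers `d`, and also `L`, because `σ` is symmetric and preserves the
integral. The case of `d^*` follows by taking adjoints, and positivity by writing `β_{it}` as the
square of the symmetric operator `β_{it/2}`.

The associated objects come from duality. The integral is `⟨·,θ⟩`; the twist on `A` comes from the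
modular property of `h` and spreads to `Ω` through products and `d`; the Hodge operator is a Riesz
map on invariant forms extended `A`-linearly; and `d^*` is `d` conjugated by it, up to sign. -/

/-! ### Corepresentation matrices and the antipode. -/

section Corepresentation

variable {A : Type*} [Ring A] [HopfAlgebra ℂ A]

/-- A finite-dimensional corepresentation matrix of a complex Hopf algebra. -/
structure IsCorepMatrix {n : ℕ} (u : Matrix (Fin n) (Fin n) A) : Prop where
  comul : ∀ i j, Coalgebra.comul (R := ℂ) (u i j) = ∑ k, u i k ⊗ₜ[ℂ] u k j
  counit : ∀ i j, Coalgebra.counit (R := ℂ) (u i j) = if i = j then 1 else 0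

namespace IsCorepMatrix

variable {n : ℕ} {u : Matrix (Fin n) (Fin n) A}

theorem antipode_mul (hu : IsCorepMatrix u) : u.map (HopfAlgebra.antipode ℂ) * u = 1 := by
  ext i j
  have := HopfAlgebra.mul_antipode_rTensor_comul_apply (R := ℂ) (u i j)
  rw [hu.comul, hu.counit] at this
  simp only [map_sum, LinearMap.rTensor_tmul, LinearMap.mul'_apply] at this
  simp only [Matrix.mul_apply, Matrix.map_apply, this, Matrix.one_apply]
  split_ifs <;> simp

theorem mul_antipode (hu : IsCorepMatrix u) : u * u.map (HopfAlgebra.antipode ℂ) = 1 := by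
  ext i j
  have := HopfAlgebra.mul_antipode_lTensor_comul_apply (R := ℂ) (u i j)
  rw [hu.comul, hu.counit] at this
  simp only [map_sum, LinearMap.lTensor_tmul, LinearMap.mul'_apply] at this
  simp only [Matrix.mul_apply, Matrix.map_apply, this, Matrix.one_apply]
  split_ifs <;> simp

theorem sum_antipode_mul (hu : IsCorepMatrix u) (i j : Fin n) :
    ∑ k, HopfAlgebra.antipode ℂ (u i k) * u k j = if i = j then 1 else 0 := by
  simpa [Matrix.mul_apply, Matrix.one_apply] using congr_fun (congr_fun hu.antipode_mul i) j

theorem sum_mul_antipode (hu : IsCorepMatrix u) (i j : Fin n) :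
    ∑ k, u i k * HopfAlgebra.antipode ℂ (u k j) = if i = j then 1 else 0 := by
  simpa [Matrix.mul_apply, Matrix.one_apply] using congr_fun (congr_fun hu.mul_antipode i) j

/-- Over `A ⊗ A` the matrix `Δ(u)` factors as `(u ⊗ 1)(1 ⊗ u)`. Both sides are entries of an inverse
of it, one a left inverse and the other a right inverse. -/
theorem comul_antipode (hu : IsCorepMatrix u) (i j : Fin n) :
    Coalgebra.comul (R := ℂ) (HopfAlgebra.antipode ℂ (u i j)) =
      ∑ k, HopfAlgebra.antipode ℂ (u k j) ⊗ₜ[ℂ] HopfAlgebra.antipode ℂ (u i k) := by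
  let S := u.map (HopfAlgebra.antipode ℂ)
  let l := (Algebra.TensorProduct.includeLeft : A →ₐ[ℂ] A ⊗[ℂ] A)
  let r := (Algebra.TensorProduct.includeRight : A →ₐ[ℂ] A ⊗[ℂ] A)
  let δ := Bialgebra.comulAlgHom ℂ A
  have hP : u.map δ = u.map l * u.map r := by
    ext i j
    simp [Matrix.mul_apply, δ, l, r, hu.comul]
  have hone : ∀ f : A →ₐ[ℂ] A ⊗[ℂ] A, ∀ x y : Matrix (Fin n) (Fin n) A, x * y = 1 →
      x.map f * y.map f = 1 := fun f x y hxy => by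
    rw [← Matrix.map_mul, hxy, Matrix.map_one _ (map_zero f) (map_one f)]
  have h1 : S.map δ * u.map δ = 1 := hone δ _ _ hu.antipode_mul
  have h2 : u.map δ * (S.map r * S.map l) = 1 := by
    rw [hP, Matrix.mul_assoc, ← Matrix.mul_assoc (u.map r), hone r _ _ hu.mul_antipode,
      Matrix.one_mul, hone l _ _ hu.mul_antipode]
  have h3 := left_inv_eq_right_inv h1 h2
  have := congr_fun (congr_fun h3 i) j
  simpa [Matrix.mul_apply, S, δ, l, r] using this

theorem antipode_transpose (hu : IsCorepMatrix u) :
    IsCorepMatrix (u.map (HopfAlgebra.antipode ℂ)).transpose where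
  comul i j := by simpa using hu.comul_antipode j i
  counit i j := by simp [hu.counit, eq_comm]

theorem antipode_antipode (hu : IsCorepMatrix u) :
    IsCorepMatrix ((u.map (HopfAlgebra.antipode ℂ)).map (HopfAlgebra.antipode ℂ)) :=
  hu.antipode_transpose.antipode_transpose

end IsCorepMatrix

end Corepresentation

/-! ### Modular property and uniqueness of the Haar integral. -/

section Haar

variable {A : Type*} [Ring A] [HopfAlgebra ℂ A] [StarRing A] {h : A →ₗ[ℂ] ℂ}

namespace IsHaarIntegral

/-- Invariance of `h` on `x * u i j` is a linear system for the slices of `Δ(x)` with matrix `u`;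
multiplying by `S(u)` solves it. -/
theorem comul_mul_right {n : ℕ} {u : Matrix (Fin n) (Fin n) A} (hh : IsHaarIntegral h)
    (hu : IsCorepMatrix u) (x : A) (i j : Fin n) :
    TensorProduct.lid ℂ A (TensorProduct.map (h ∘ₗ LinearMap.mulRight ℂ (u i j)) LinearMap.id
      (Coalgebra.comul x)) = ∑ k, h (x * u i k) • HopfAlgebra.antipode ℂ (u k j) := by
  set E : A → A := fun b => TensorProduct.lid ℂ A
    (TensorProduct.map (h ∘ₗ LinearMap.mulRight ℂ b) LinearMap.id (Coalgebra.comul x)) with hE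
  have key : ∀ j, ∑ k, E (u i k) * u k j = h (x * u i j) • (1 : A) := by
    intro j
    rw [← hh.left_inv, Bialgebra.comul_mul, hu.comul]
    simp only [hE]
    induction Coalgebra.comul (R := ℂ) x using TensorProduct.induction_on with
    | zero => simp
    | tmul a b => simp [Finset.mul_sum]
    | add a b ha hb => simp only [map_add, add_mul, Finset.sum_add_distrib, ha, hb]
  change E (u i j) = _
  calc E (u i j) = ∑ m, E (u i m) * ∑ k, u m k * HopfAlgebra.antipode ℂ (u k j) := by
        simp [hu.sum_mul_antipode]
    _ = ∑ k, (∑ m, E (u i m) * u m k) * HopfAlgebra.antipode ℂ (u k j) := by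
        simp only [Finset.mul_sum, Finset.sum_mul, mul_assoc]
        exact Finset.sum_comm
    _ = _ := by simp [key]

theorem comul_mul_left {n : ℕ} {u : Matrix (Fin n) (Fin n) A} (hh : IsHaarIntegral h)
    (hu : IsCorepMatrix u) (x : A) (i j : Fin n) :
    TensorProduct.rid ℂ A (TensorProduct.map LinearMap.id (h ∘ₗ LinearMap.mulLeft ℂ (u i j))
      (Coalgebra.comul x)) = ∑ k, h (u k j * x) • HopfAlgebra.antipode ℂ (u i k) := by
  set E : A → A := fun b => TensorProduct.rid ℂ A
    (TensorProduct.map LinearMap.id (h ∘ₗ LinearMap.mulLeft ℂ b) (Coalgebra.comul x)) with hE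
  have key : ∀ i, ∑ k, u i k * E (u k j) = h (u i j * x) • (1 : A) := by
    intro i
    rw [← hh.right_inv, Bialgebra.comul_mul, hu.comul]
    simp only [hE]
    induction Coalgebra.comul (R := ℂ) x using TensorProduct.induction_on with
    | zero => simp
    | tmul a b => simp [Finset.sum_mul]
    | add a b ha hb => simp only [map_add, mul_add, Finset.sum_add_distrib, ha, hb]
  change E (u i j) = _
  calc E (u i j) = ∑ m, (∑ k, HopfAlgebra.antipode ℂ (u i k) * u k m) * E (u m j) := by
        simp [hu.sum_antipode_mul]
    _ = ∑ k, HopfAlgebra.antipode ℂ (u i k) * (∑ m, u k m * E (u m j)) := by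
        simp only [Finset.mul_sum, Finset.sum_mul, mul_assoc]
        exact Finset.sum_comm
    _ = _ := by simp [key]

/-- The Haar integral has a modular automorphism, on the coefficients of a corepresentation. -/
theorem exists_modular_coeff {n : ℕ} {u : Matrix (Fin n) (Fin n) A} (hh : IsHaarIntegral h)
    (hu : IsCorepMatrix u) (i l : Fin n) : ∃ c : A, ∀ x : A, h (x * u i l) = h (c * x) := by
  set S := HopfAlgebra.antipode ℂ (A := A)
  set w := (u.map S).map S with hw
  have hwc : IsCorepMatrix w := hu.antipode_antipode
  -- The witness arises from computing `(h(· u i j) ⊗ h(w j l ·)) Δ(x)` in two ways and summing over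
  -- `j`. The choice `w = S²(u)` is what makes `∑ j, w j l * S (u k j)` collapse to `δ_{kl}`.
  refine ⟨∑ j, ∑ m, h (S (w j m) * u i j) • w m l, fun x => ?_⟩
  have h1 : ∀ j, ∑ m, h (S (w j m) * u i j) * h (w m l * x) =
      h (w j l * ∑ k, h (x * u i k) • S (u k j)) := by
    intro j
    rw [← hh.comul_mul_right hu]
    have : ∑ m, h (S (w j m) * u i j) * h (w m l * x) =
        h ((∑ m, h (w m l * x) • S (w j m)) * u i j) := by
      simp [Finset.sum_mul, mul_comm]
    rw [this, ← hh.comul_mul_left hwc]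
    induction Coalgebra.comul (R := ℂ) x using TensorProduct.induction_on with
    | zero => simp
    | tmul a b => simp [mul_comm]
    | add a b ha hb => simp only [map_add, mul_add, add_mul, ha, hb]
  have h2 : ∀ k, ∑ j, w j l * S (u k j) = if k = l then 1 else 0 := by
    intro k
    have : ∑ j, w j l * S (u k j) = S (∑ j, u k j * S (u j l)) := by
      simp [hw, S, map_sum, HopfAlgebra.antipode_mul_antidistrib]
    rw [this, hu.sum_mul_antipode]
    split_ifs
    · exact HopfAlgebra.antipode_one
    · simp
  symm
  calc h ((∑ j, ∑ m, h (S (w j m) * u i j) • w m l) * x)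
      = ∑ j, ∑ m, h (S (w j m) * u i j) * h (w m l * x) := by
        simp [Finset.sum_mul]
    _ = ∑ j, ∑ k, h (x * u i k) * h (w j l * S (u k j)) := by
        simp [h1, Finset.mul_sum]
    _ = ∑ k, h (x * u i k) * h (∑ j, w j l * S (u k j)) := by
        rw [Finset.sum_comm]
        simp [Finset.mul_sum]
    _ = h (x * u i l) := by
        simp only [h2]
        rw [Finset.sum_eq_single l] <;> simp +contextual [hh.map_one]

/-- A linear functional `φ` with `(id ⊗ φ) Δ(a) = φ(a) 1` is a multiple of the Haar integral. -/
theorem eq_smul_of_left_invariant (hh : IsHaarIntegral h) (φ : A →ₗ[ℂ] ℂ)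
    (hφ : ∀ a : A, TensorProduct.rid ℂ A (TensorProduct.map LinearMap.id φ (Coalgebra.comul a)) =
      φ a • (1 : A)) (a : A) : φ a = h a * φ 1 := by
  -- Both sides are `(h ⊗ φ) Δ(a)`.
  have h1 : h (TensorProduct.rid ℂ A (TensorProduct.map LinearMap.id φ (Coalgebra.comul a))) =
      φ (TensorProduct.lid ℂ A (TensorProduct.map h LinearMap.id (Coalgebra.comul a))) := by
    induction Coalgebra.comul (R := ℂ) a using TensorProduct.induction_on with
    | zero => simp
    | tmul a b => simp [mul_comm]
    | add a b ha hb => simp only [map_add, ha, hb]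
  rw [hφ, hh.left_inv] at h1
  simpa [hh.map_one] using h1

end IsHaarIntegral

end Haar

/-! ### Compatibility of counit and antipode with the involution. -/

section HopfStar

variable {A : Type*} [Ring A] [HopfAlgebra ℂ A] [StarRing A] [StarModule ℂ A] [HopfStarAlgebra A]

/-- The functional `a ↦ conj ε(a^*)` is again a left counit, and a left counit agrees with the right
counit `ε`. -/
theorem counit_star (a : A) :
    Coalgebra.counit (R := ℂ) (star a) = conj (Coalgebra.counit (R := ℂ) a) := by
  let φ : A →ₗ[ℂ] ℂ :=
    { toFun := fun a => conj (Coalgebra.counit (R := ℂ) (star a))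
      map_add' := by simp
      map_smul' := by simp }
  have h1 : ∀ x : A ⊗[ℂ] A, TensorProduct.lid ℂ A (TensorProduct.map φ LinearMap.id x) =
      star (TensorProduct.lid ℂ A
        (TensorProduct.map Coalgebra.counit LinearMap.id (star x))) := by
    intro x
    induction x using TensorProduct.induction_on with
    | zero => simp
    | tmul a b => simp [φ, star_smul]
    | add a b ha hb => simp only [map_add, star_add, ha, hb]
  have h2 : TensorProduct.lid ℂ A (TensorProduct.map φ LinearMap.id (Coalgebra.comul a)) = a := by
    rw [h1, ← HopfStarAlgebra.comul_star]
    have := Coalgebra.rTensor_counit_comul (R := ℂ) (star a)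
    rw [LinearMap.rTensor_def] at this
    simp [this]
  have h3 : Coalgebra.counit (R := ℂ)
      (TensorProduct.lid ℂ A (TensorProduct.map φ LinearMap.id (Coalgebra.comul (R := ℂ) a))) =
      φ (TensorProduct.rid ℂ A
        (TensorProduct.map LinearMap.id Coalgebra.counit (Coalgebra.comul (R := ℂ) a))) := by
    induction Coalgebra.comul (R := ℂ) a using TensorProduct.induction_on with
    | zero => simp
    | tmul a b => simp [mul_comm]
    | add a b ha hb => simp only [map_add, ha, hb]
  have h4 := Coalgebra.lTensor_counit_comul (R := ℂ) a
  rw [LinearMap.lTensor_def] at h4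
  rw [h2, h4] at h3
  simp [φ, h3]

theorem IsCorepMatrix.star {n : ℕ} {u : Matrix (Fin n) (Fin n) A} (hu : IsCorepMatrix u) :
    IsCorepMatrix (u.map Star.star) where
  comul i j := by simp [HopfStarAlgebra.comul_star, hu.comul, star_sum]
  counit i j := by
    simp only [Matrix.map_apply, counit_star, hu.counit]
    split_ifs <;> simp

/-- Both sides are entries of inverses of the matrix `S(u)`. This makes the antipode injective on
`A`, which is not an assumption. -/
theorem IsCorepMatrix.antipode_star_antipode_star {n : ℕ} {u : Matrix (Fin n) (Fin n) A}
    (hu : IsCorepMatrix u) (i j : Fin n) :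
    HopfAlgebra.antipode ℂ (Star.star (HopfAlgebra.antipode ℂ (Star.star (u i j)))) = u i j := by
  set S := HopfAlgebra.antipode ℂ (A := A)
  let z : Matrix (Fin n) (Fin n) A := Matrix.of fun i k => Star.star (S (Star.star (u i k)))
  have h1 : z.map S * u.map S = 1 := by
    ext i j
    have h := congr_arg Star.star (hu.star.sum_antipode_mul i j)
    simp only [Matrix.map_apply, star_sum, star_mul, star_star] at h
    have h' : ∑ k, S (z i k) * S (u k j) = S (∑ k, u k j * z i k) := by
      simp [S, HopfAlgebra.antipode_mul_antidistrib]
    simp only [Matrix.mul_apply, Matrix.map_apply, h', Matrix.one_apply]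
    simp only [z, Matrix.of_apply, S, h]
    split_ifs <;> simp [HopfAlgebra.antipode_one]
  have := left_inv_eq_right_inv h1 hu.antipode_mul
  simpa [z] using congr_fun (congr_fun this i) j

end HopfStar

/-! ### Linear maps on direct sums, inner products and slice maps. -/

section Glue

variable {V M κ : Type*} [DecidableEq κ] [AddCommGroup V] [Module ℂ V] [AddCommMonoid M]
  [Module ℂ M] {p : κ → Submodule ℂ V}

/-- The linear map with given restrictions to the summands of an internal direct sum. -/
noncomputable def DirectSum.IsInternal.linearGlue (hp : DirectSum.IsInternal p)
    (f : ∀ k, p k →ₗ[ℂ] M) : V →ₗ[ℂ] M :=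
  DirectSum.toModule ℂ κ M f ∘ₗ
    (LinearEquiv.ofBijective (DirectSum.coeLinearMap p) hp).symm.toLinearMap

theorem DirectSum.IsInternal.linearGlue_apply (hp : DirectSum.IsInternal p)
    (f : ∀ k, p k →ₗ[ℂ] M) {k : κ} {x : V} (hx : x ∈ p k) : hp.linearGlue f x = f k ⟨x, hx⟩ := by
  have : (LinearEquiv.ofBijective (DirectSum.coeLinearMap p) hp).symm x =
      DirectSum.lof ℂ κ (fun k => p k) k ⟨x, hx⟩ := by
    rw [LinearEquiv.symm_apply_eq]
    exact (DirectSum.coeLinearMap_lof p k ⟨x, hx⟩).symm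
  simp [linearGlue, this]

end Glue

section InnerProduct

variable {V : Type*} [AddCommGroup V] [Module ℂ V] (ip : InnerProductSpace.Core ℂ V)

theorem ipForm_add_left (x y z : V) : ipForm ip (x + y) z = ipForm ip x z + ipForm ip y z := by
  simp only [ipForm, ← ip.conj_inner_symm z, ip.add_left, map_add]

theorem ipForm_smul_left (c : ℂ) (x z : V) : ipForm ip (c • x) z = c * ipForm ip x z := by
  simp only [ipForm, ← ip.conj_inner_symm z, ip.smul_left, map_mul, Complex.conj_conj]

theorem ipForm_conj (x y : V) : conj (ipForm ip x y) = ipForm ip y x :=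
  by
  rw [ipForm, ip.conj_inner_symm, ipForm]

/-- The inner product as a linear functional of its first argument. -/
def ipLeft (z : V) : V →ₗ[ℂ] ℂ where
  toFun x := ipForm ip x z
  map_add' x y := ipForm_add_left ip x y z
  map_smul' c x := ipForm_smul_left ip c x z

@[simp] theorem ipLeft_apply (x z : V) : ipLeft ip z x = ipForm ip x z := rfl

theorem ipForm_add_right (x y z : V) : ipForm ip x (y + z) = ipForm ip x y + ipForm ip x z :=
  ip.add_left y z x

theorem ipForm_smul_right (c : ℂ) (x z : V) : ipForm ip x (c • z) = conj c * ipForm ip x z :=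
  ip.smul_left z x c

@[simp] theorem ipForm_zero_left (z : V) : ipForm ip 0 z = 0 := map_zero (ipLeft ip z)

@[simp] theorem ipForm_zero_right (z : V) : ipForm ip z 0 = 0 := by
  rw [← ipForm_conj, ipForm_zero_left, map_zero]

theorem ipForm_sum_left {κ : Type*} (s : Finset κ) (f : κ → V) (z : V) :
    ipForm ip (∑ i ∈ s, f i) z = ∑ i ∈ s, ipForm ip (f i) z := map_sum (ipLeft ip z) f s

theorem ipForm_sum_right {κ : Type*} (s : Finset κ) (f : κ → V) (z : V) :
    ipForm ip z (∑ i ∈ s, f i) = ∑ i ∈ s, ipForm ip z (f i) := by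
  rw [← ipForm_conj, ipForm_sum_left, map_sum]
  simp only [ipForm_conj]

theorem ipForm_definite {x : V} (hx : ipForm ip x x = 0) : x = 0 := ip.definite x hx

theorem ipForm_self_nonneg (x : V) : 0 ≤ ipForm ip x x := by
  rw [Complex.nonneg_iff]
  refine ⟨ip.re_inner_nonneg x, ?_⟩
  have := congr_arg Complex.im (ipForm_conj ip x x)
  rw [Complex.conj_im] at this
  linarith

theorem ipForm_ext_right {x y : V} (hxy : ∀ z, ipForm ip z x = ipForm ip z y) : x = y := by
  rw [← sub_eq_zero]
  apply ipForm_definite ip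
  have h1 : ∀ z, ipForm ip z (x - y) = 0 := fun z => by
    rw [sub_eq_add_neg, ← neg_one_smul ℂ y, ipForm_add_right, ipForm_smul_right, hxy]
    simp
  exact h1 _

theorem exists_orthonormal_span_eq (W : Submodule ℂ V) [FiniteDimensional ℂ W] :
    ∃ (n : ℕ) (v : Fin n → V), (∀ i j, ipForm ip (v i) (v j) = if i = j then 1 else 0) ∧
      Submodule.span ℂ (Set.range v) = W := by
  let : NormedAddCommGroup V := ip.toNormedAddCommGroup
  let : InnerProductSpace ℂ V := InnerProductSpace.ofCore ip.toCore
  let b := stdOrthonormalBasis ℂ W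
  refine ⟨_, fun i => (b i : V), fun i j => ?_, ?_⟩
  · have := orthonormal_iff_ite.1 b.orthonormal j i
    rw [Submodule.coe_inner] at this
    simp only [eq_comm (a := i)]
    exact this
  · have := congr_arg (Submodule.map W.subtype) b.toBasis.span_eq
    rw [Submodule.map_span, ← Set.range_comp, Submodule.map_subtype_top] at this
    simpa [Function.comp_def] using this

theorem eq_sum_of_mem_span_orthonormal {n : ℕ} {v : Fin n → V}
    (hv : ∀ i j, ipForm ip (v i) (v j) = if i = j then 1 else 0) {x : V}
    (hx : x ∈ Submodule.span ℂ (Set.range v)) : x = ∑ i, ipForm ip x (v i) • v i := by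
  obtain ⟨c, rfl⟩ := (Submodule.mem_span_range_iff_exists_fun ℂ).1 hx
  refine Finset.sum_congr rfl fun i _ => ?_
  simp [ipForm_sum_left, ipForm_smul_left, hv]

end InnerProduct

section Slice

variable {A V : Type*} [Ring A] [Algebra ℂ A] [AddCommGroup V] [Module ℂ V]

/-- The slice map `id ⊗ φ`. -/
noncomputable def slice (φ : V →ₗ[ℂ] ℂ) : A ⊗[ℂ] V →ₗ[ℂ] A :=
  (TensorProduct.rid ℂ A).toLinearMap ∘ₗ TensorProduct.map LinearMap.id φ

@[simp] theorem slice_tmul (φ : V →ₗ[ℂ] ℂ) (a : A) (v : V) : slice φ (a ⊗ₜ[ℂ] v) = φ v • a := by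
  simp [slice]

theorem slice_comp (φ : V →ₗ[ℂ] ℂ) (T : V →ₗ[ℂ] V)
    (x : A ⊗[ℂ] V) :
    slice φ (TensorProduct.map LinearMap.id T x) = slice (φ ∘ₗ T) x := by
  induction x using TensorProduct.induction_on with
  | zero => simp
  | tmul a b => simp
  | add a b ha hb => simp only [map_add, ha, hb]

/-- The slice map `φ ⊗ id`. -/
noncomputable def leftSlice (φ : A →ₗ[ℂ] ℂ) : A ⊗[ℂ] V →ₗ[ℂ] V :=
  (TensorProduct.lid ℂ V).toLinearMap ∘ₗ TensorProduct.map φ LinearMap.id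

@[simp] theorem leftSlice_tmul (φ : A →ₗ[ℂ] ℂ) (a : A) (v : V) :
    leftSlice φ (a ⊗ₜ[ℂ] v) = φ a • v := by
  simp [leftSlice]

variable (A) in
/-- The subspace `A ⊗ W` of `A ⊗ V`. -/
def tensorSubmodule (W : Submodule ℂ V) : Submodule ℂ (A ⊗[ℂ] V) :=
  Submodule.span ℂ {x | ∃ (a : A) (w : V), w ∈ W ∧ x = a ⊗ₜ[ℂ] w}

theorem tmul_mem_tensorSubmodule {W : Submodule ℂ V} (a : A) {w : V} (hw : w ∈ W) :
    a ⊗ₜ[ℂ] w ∈ tensorSubmodule A W := Submodule.subset_span ⟨a, w, hw, rfl⟩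

theorem eq_sum_slice (ip : InnerProductSpace.Core ℂ V) {n : ℕ} {v : Fin n → V}
    (hv : ∀ i j, ipForm ip (v i) (v j) = if i = j then 1 else 0) {x : A ⊗[ℂ] V}
    (hx : x ∈ tensorSubmodule A (Submodule.span ℂ (Set.range v))) :
    x = ∑ k, slice (ipLeft ip (v k)) x ⊗ₜ[ℂ] v k := by
  induction hx using Submodule.span_induction with
  | mem x hx =>
    obtain ⟨a, w, hw, rfl⟩ := hx
    conv_lhs => rw [eq_sum_of_mem_span_orthonormal ip hv hw]
    simp [TensorProduct.tmul_sum, TensorProduct.smul_tmul]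
  | zero => simp
  | add x y _ _ hx hy =>
    simp only [map_add, TensorProduct.add_tmul, Finset.sum_add_distrib, ← hx, ← hy]
  | smul c x _ hx =>
    simp only [map_smul, ← TensorProduct.smul_tmul', ← Finset.smul_sum, ← hx]

end Slice

/-! ### The grading, and the coaction as a comodule structure. -/

namespace StarDifferentialCalculus

variable {A Ω : Type*} [Ring A] [HopfAlgebra ℂ A] [StarRing A]
  [Ring Ω] [Algebra ℂ Ω] [StarAddMonoid Ω] (Γ : StarDifferentialCalculus A Ω)

section Grading

@[elab_as_elim]
theorem homogeneous_induction {p : Ω → Prop} (ω : Ω) (hom : ∀ k, ∀ ω ∈ Γ.form k, p ω)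
    (add : ∀ ω η, p ω → p η → p (ω + η)) : p ω := by
  have : ω ∈ ⨆ k, Γ.form k := by
    rw [Γ.isInternal.submodule_iSup_eq_top]; trivial
  exact Submodule.iSup_induction _ (motive := p) this hom (hom 0 0 (zero_mem _)) add

theorem hom_ext {M : Type*} [AddCommMonoid M] [Module ℂ M] {f g : Ω →ₗ[ℂ] M}
    (hfg : ∀ k, ∀ ω ∈ Γ.form k, f ω = g ω) : f = g :=
  LinearMap.ext fun ω => Γ.homogeneous_induction ω hfg fun ω η h1 h2 => by simp [h1, h2]

/-- A linear map given on each homogeneous component. -/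
noncomputable def glue {M : Type*} [AddCommMonoid M] [Module ℂ M]
    (f : ∀ k, Γ.form k →ₗ[ℂ] M) : Ω →ₗ[ℂ] M := Γ.isInternal.linearGlue f

theorem glue_apply {M : Type*} [AddCommMonoid M] [Module ℂ M] (f : ∀ k, Γ.form k →ₗ[ℂ] M)
    {k : ℕ} {ω : Ω} (hω : ω ∈ Γ.form k) : Γ.glue f ω = f k ⟨ω, hω⟩ :=
  Γ.isInternal.linearGlue_apply f hω

/-- The projection onto the `k`-forms. -/
noncomputable def proj (k : ℕ) : Ω →ₗ[ℂ] Ω :=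
  Γ.glue fun l => if l = k then (Γ.form l).subtype else 0

theorem proj_of_mem {k : ℕ} {ω : Ω} (hω : ω ∈ Γ.form k) : Γ.proj k ω = ω := by
  simp [proj, Γ.glue_apply _ hω]

theorem proj_of_ne {k l : ℕ} (hkl : l ≠ k) {ω : Ω} (hω : ω ∈ Γ.form l) : Γ.proj k ω = 0 := by
  simp [proj, Γ.glue_apply _ hω, hkl]

theorem proj_mem (k : ℕ) (ω : Ω) : Γ.proj k ω ∈ Γ.form k := by
  refine Γ.homogeneous_induction ω (fun l ω hω => ?_) fun ω η h1 h2 => by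
    rw [map_add]; exact add_mem h1 h2
  by_cases hl : l = k
  · subst hl; rwa [Γ.proj_of_mem hω]
  · rw [Γ.proj_of_ne hl hω]; exact zero_mem _

theorem exists_eq_sum_proj (ω : Ω) :
    ∃ m, ∀ n, m ≤ n → ω = ∑ k ∈ Finset.range n, Γ.proj k ω := by
  refine Γ.homogeneous_induction ω (fun k ω hω => ⟨k + 1, fun n hn => ?_⟩) ?_
  · rw [Finset.sum_eq_single k (fun l _ hl => Γ.proj_of_ne (Ne.symm hl) hω)
      (fun hk => absurd (Finset.mem_range.2 hn) hk), Γ.proj_of_mem hω]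
  · rintro ω η ⟨m, hm⟩ ⟨m', hm'⟩
    refine ⟨max m m', fun n hn => ?_⟩
    simp only [map_add, Finset.sum_add_distrib]
    rw [← hm n (le_of_max_le_left hn), ← hm' n (le_of_max_le_right hn)]

theorem eq_of_proj_eq {ω η : Ω} (hωη : ∀ k, Γ.proj k ω = Γ.proj k η) : ω = η := by
  obtain ⟨m, hm⟩ := Γ.exists_eq_sum_proj ω
  obtain ⟨n, hn⟩ := Γ.exists_eq_sum_proj η
  rw [hm _ (le_max_left m n), hn _ (le_max_right m n)]
  exact Finset.sum_congr rfl fun k _ => hωη k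

theorem ι_mem (a : A) : Γ.ι a ∈ Γ.form 0 := by
  rw [← Γ.ι_range]; exact ⟨a, rfl⟩

theorem exists_ι_eq {ω : Ω} (hω : ω ∈ Γ.form 0) : ∃ a, Γ.ι a = ω := by
  rw [← Γ.ι_range] at hω; exact hω

theorem ι_mul_mem (a : A) {k : ℕ} {ω : Ω} (hω : ω ∈ Γ.form k) : Γ.ι a * ω ∈ Γ.form k := by
  simpa using Γ.mul_mem 0 k _ _ (Γ.ι_mem a) hω

theorem mul_ι_mem (a : A) {k : ℕ} {ω : Ω} (hω : ω ∈ Γ.form k) : ω * Γ.ι a ∈ Γ.form k := by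
  simpa using Γ.mul_mem k 0 _ _ hω (Γ.ι_mem a)

theorem one_mem : (1 : Ω) ∈ Γ.form 0 := by simpa using Γ.ι_mem 1

/-- Induction over forms: a predicate on homogeneous forms that holds on `A` and `dA` and is
compatible with the vector space operations and with products holds everywhere. -/
theorem form_induction {p : ℕ → Ω → Prop} (zero : ∀ k, p k 0)
    (add : ∀ k ω η, p k ω → p k η → p k (ω + η)) (smul : ∀ k (c : ℂ) ω, p k ω → p k (c • ω))
    (mul : ∀ k l ω η, p k ω → p l η → p (k + l) (ω * η)) (ι : ∀ a, p 0 (Γ.ι a))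
    (d : ∀ a, p 1 (Γ.d (Γ.ι a))) (k : ℕ) (ω : Ω) (hω : ω ∈ Γ.form k) : p k ω := by
  have hprod : ∀ (k : ℕ) (a : Fin k → A), p k (List.ofFn fun j => Γ.d (Γ.ι (a j))).prod := by
    intro k
    induction k with
    | zero => intro a; simpa using ι 1
    | succ k ih =>
      intro a
      rw [List.ofFn_succ, List.prod_cons]
      have := mul _ _ _ _ (d (a 0)) (ih fun j => a j.succ)
      rwa [add_comm 1 k] at this
  rcases Nat.eq_zero_or_pos k with rfl | hk
  · obtain ⟨a, rfl⟩ := Γ.exists_ι_eq hω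
    exact ι a
  · rw [Γ.form_eq_span k hk] at hω
    induction hω using Submodule.span_induction with
    | mem ω hω =>
      obtain ⟨a₀, a, rfl⟩ := hω
      simpa using mul 0 k _ _ (ι a₀) (hprod k a)
    | zero => exact zero k
    | add ω η _ _ h1 h2 => exact add k ω η h1 h2
    | smul c ω _ h1 => exact smul k c ω h1

theorem algHom_ext {B : Type*} [Ring B] [Algebra ℂ B] {f g : Ω →ₐ[ℂ] B}
    (hι : ∀ a, f (Γ.ι a) = g (Γ.ι a)) (hd : ∀ a, f (Γ.d (Γ.ι a)) = g (Γ.d (Γ.ι a))) : f = g := by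
  have : f.toLinearMap = g.toLinearMap := Γ.hom_ext <| Γ.form_induction (p := fun _ ω => f ω = g ω)
    (by simp) (by simp +contextual) (by simp +contextual) (by simp +contextual) hι hd
  exact AlgHom.toLinearMap_injective this

end Grading

section Coaction

/-- The definition of a calculus does not include coassociativity. Both sides are algebra
homomorphisms in `ω`, so it is enough to compare them on `A` and `dA`, where the claim reduces to
coassociativity of `Δ`. -/
theorem coact_coassoc (ω : Ω) :
    TensorProduct.assoc ℂ A A Ω (TensorProduct.map Coalgebra.comul LinearMap.id (Γ.coact ω)) =
      TensorProduct.map LinearMap.id Γ.coact.toLinearMap (Γ.coact ω) := by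
  have key : ∀ (f : A →ₗ[ℂ] Ω)
      (_ : ∀ a, Γ.coact (f a) = TensorProduct.map LinearMap.id f (Coalgebra.comul (R := ℂ) a))
      (a : A), TensorProduct.assoc ℂ A A Ω
        (TensorProduct.map Coalgebra.comul LinearMap.id (Γ.coact (f a))) =
        TensorProduct.map LinearMap.id Γ.coact.toLinearMap (Γ.coact (f a)) := by
    intro f hf a
    have h1 : ∀ x : (A ⊗[ℂ] A), TensorProduct.assoc ℂ A A Ω
        (TensorProduct.map Coalgebra.comul LinearMap.id (TensorProduct.map LinearMap.id f x)) =
        TensorProduct.map LinearMap.id (TensorProduct.map LinearMap.id f)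
          (TensorProduct.assoc ℂ A A A (Coalgebra.comul.rTensor A x)) := by
      intro x
      induction x using TensorProduct.induction_on with
      | zero => simp
      | tmul a b =>
        simp only [TensorProduct.map_tmul, LinearMap.rTensor_tmul, LinearMap.id_apply]
        induction Coalgebra.comul (R := ℂ) a using TensorProduct.induction_on with
        | zero => simp
        | tmul a b => simp
        | add a b ha hb => simp only [map_add, TensorProduct.add_tmul, ha, hb]
      | add a b ha hb => simp only [map_add, ha, hb]
    have h2 : ∀ x : (A ⊗[ℂ] A),
        TensorProduct.map LinearMap.id Γ.coact.toLinearMap (TensorProduct.map LinearMap.id f x) =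
        TensorProduct.map LinearMap.id (TensorProduct.map LinearMap.id f)
          (Coalgebra.comul.lTensor A x) := by
      intro x
      induction x using TensorProduct.induction_on with
      | zero => simp
      | tmul a b => simp [hf]
      | add a b ha hb => simp only [map_add, ha, hb]
    rw [hf, h1, h2, Coalgebra.coassoc_apply]
  let F : Ω →ₐ[ℂ] A ⊗[ℂ] (A ⊗[ℂ] Ω) :=
    ((Algebra.TensorProduct.assoc ℂ ℂ ℂ A A Ω).toAlgHom.comp
      (Algebra.TensorProduct.map (Bialgebra.comulAlgHom ℂ A) (AlgHom.id ℂ Ω))).comp Γ.coact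
  let G : Ω →ₐ[ℂ] A ⊗[ℂ] (A ⊗[ℂ] Ω) :=
    (Algebra.TensorProduct.map (AlgHom.id ℂ A) Γ.coact).comp Γ.coact
  have hFG : F = G := Γ.algHom_ext (key Γ.ι.toLinearMap Γ.coact_ι)
    (key (Γ.d ∘ₗ Γ.ι.toLinearMap) fun a => by
      simp [Γ.coact_d, Γ.coact_ι, TensorProduct.map_map])
  exact DFunLike.congr_fun hFG ω

theorem coact_counit (ω : Ω) :
    TensorProduct.lid ℂ Ω (TensorProduct.map Coalgebra.counit LinearMap.id (Γ.coact ω)) = ω := by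
  have key : ∀ (f : A →ₗ[ℂ] Ω)
      (_ : ∀ a, Γ.coact (f a) = TensorProduct.map LinearMap.id f (Coalgebra.comul (R := ℂ) a))
      (a : A), TensorProduct.lid ℂ Ω
        (TensorProduct.map Coalgebra.counit LinearMap.id (Γ.coact (f a))) = f a := by
    intro f hf a
    have h1 : ∀ x : (A ⊗[ℂ] A), TensorProduct.lid ℂ Ω
        (TensorProduct.map Coalgebra.counit LinearMap.id (TensorProduct.map LinearMap.id f x)) =
        f (TensorProduct.lid ℂ A (Coalgebra.counit.rTensor A x)) := by
      intro x
      induction x using TensorProduct.induction_on with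
      | zero => simp
      | tmul a b => simp
      | add a b ha hb => simp only [map_add, ha, hb]
    rw [hf, h1, Coalgebra.rTensor_counit_comul]
    simp
  let F : Ω →ₐ[ℂ] Ω :=
    ((Algebra.TensorProduct.lid ℂ Ω).toAlgHom.comp
      (Algebra.TensorProduct.map (Bialgebra.counitAlgHom ℂ A) (AlgHom.id ℂ Ω))).comp Γ.coact
  have hF : F = AlgHom.id ℂ Ω := Γ.algHom_ext (key Γ.ι.toLinearMap Γ.coact_ι)
    (key (Γ.d ∘ₗ Γ.ι.toLinearMap) fun a => by
      simp [Γ.coact_d, Γ.coact_ι, TensorProduct.map_map])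
  exact DFunLike.congr_fun hF ω

theorem coact_mem (k : ℕ) (ω : Ω) (hω : ω ∈ Γ.form k) :
    Γ.coact ω ∈ tensorSubmodule A (Γ.form k) := by
  have key : ∀ (k : ℕ) (f : A →ₗ[ℂ] Ω), (∀ a, f a ∈ Γ.form k) → ∀ x : A ⊗[ℂ] A,
      TensorProduct.map LinearMap.id f x ∈ tensorSubmodule A (Γ.form k) := by
    intro k f hf x
    induction x using TensorProduct.induction_on with
    | zero => simp
    | tmul a b => exact tmul_mem_tensorSubmodule a (hf b)
    | add a b ha hb => rw [map_add]; exact add_mem ha hb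
  refine Γ.form_induction (p := fun k ω => Γ.coact ω ∈ tensorSubmodule A (Γ.form k))
    (by simp) (fun k ω η h1 h2 => by rw [map_add]; exact add_mem h1 h2)
    (fun k c ω h1 => by rw [map_smul]; exact Submodule.smul_mem _ _ h1) ?_
    (fun a => by rw [Γ.coact_ι]; exact key 0 _ Γ.ι_mem _)
    (fun a => by
      rw [Γ.coact_d, Γ.coact_ι, TensorProduct.map_map]
      exact key 1 _ (fun a => Γ.d_mem 0 _ (Γ.ι_mem a)) _) k ω hω
  intro k l ω η h1 h2
  rw [map_mul]
  refine (Submodule.mul_le (P := tensorSubmodule A (Γ.form (k + l)))).1 ?_ _ h1 _ h2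
  rw [tensorSubmodule, tensorSubmodule, Submodule.span_mul_span, Submodule.span_le]
  rintro _ ⟨_, ⟨a, ω, hω, rfl⟩, _, ⟨b, η, hη, rfl⟩, rfl⟩
  simpa using tmul_mem_tensorSubmodule (a * b) (Γ.mul_mem k l _ _ hω hη)

theorem coact_proj (k : ℕ) (ω : Ω) :
    Γ.coact (Γ.proj k ω) = TensorProduct.map LinearMap.id (Γ.proj k) (Γ.coact ω) := by
  have h : ∀ l, ∀ x ∈ tensorSubmodule A (Γ.form l),
      TensorProduct.map LinearMap.id (Γ.proj k) x = if l = k then x else 0 := by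
    intro l x hx
    induction hx using Submodule.span_induction with
    | mem x hx =>
      obtain ⟨a, w, hw, rfl⟩ := hx
      split_ifs with hl
      · subst hl; simp [Γ.proj_of_mem hw]
      · simp [Γ.proj_of_ne hl hw]
    | zero => simp
    | add x y _ _ hx hy => rw [map_add, hx, hy]; split_ifs <;> simp
    | smul c x _ hx => rw [map_smul, hx]; split_ifs <;> simp
  refine Γ.homogeneous_induction ω (fun l ω hω => ?_) fun ω η h1 h2 => by simp [h1, h2]
  rw [h l _ (Γ.coact_mem l ω hω)]
  split_ifs with hl
  · subst hl; rw [Γ.proj_of_mem hω]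
  · rw [Γ.proj_of_ne hl hω, map_zero]

theorem mem_inv {ω : Ω} : ω ∈ Γ.inv ↔ Γ.coact ω = 1 ⊗ₜ[ℂ] ω := Iff.rfl

end Coaction

end StarDifferentialCalculus

/-! ### Local finiteness, and generation by invariant forms. -/

namespace StarDifferentialCalculus

variable {A Ω : Type*} [Ring A] [HopfAlgebra ℂ A] [StarRing A]
  [Ring Ω] [Algebra ℂ Ω] [StarAddMonoid Ω] (Γ : StarDifferentialCalculus A Ω)

section Subcomodule

/-- `v` spans a subcomodule of `Ω` with coefficient matrix `u`, and is orthonormal. -/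
structure IsOrthonormalSubcomodule (ip : InnerProductSpace.Core ℂ Ω) {n : ℕ} (v : Fin n → Ω)
    (u : Matrix (Fin n) (Fin n) A) : Prop where
  orthonormal : ∀ i j, ipForm ip (v i) (v j) = if i = j then 1 else 0
  coact_eq : ∀ j, Γ.coact (v j) = ∑ k, u j k ⊗ₜ[ℂ] v k

/-- Expand `Δ_Ω(ω)` along a basis of `A`: the finitely many second legs span the subcomodule. The
counit recovers `ω` and coassociativity gives stability. -/
theorem exists_finiteDimensional_subcomodule (k : ℕ) {ω : Ω} (hω : ω ∈ Γ.form k) :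
    ∃ V : Submodule ℂ Ω, FiniteDimensional ℂ V ∧ V ≤ Γ.form k ∧ ω ∈ V ∧
      ∀ η ∈ V, Γ.coact η ∈ tensorSubmodule A V := by
  let b := Module.Basis.ofVectorSpace ℂ A
  obtain ⟨c, hc⟩ := TensorProduct.eq_repr_basis_left b (Γ.coact ω)
  have hsl : ∀ i, leftSlice (b.coord i) (Γ.coact ω) = c i := by
    intro i
    rw [← hc, Finsupp.sum, map_sum]
    simp only [leftSlice_tmul, Module.Basis.coord_apply, Module.Basis.repr_self]
    rw [Finset.sum_eq_single i (fun j _ hj => by simp [hj]) (fun hi => by simpa using hi)]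
    simp
  refine ⟨Submodule.span ℂ (c '' c.support),
    FiniteDimensional.span_of_finite ℂ (c.support.finite_toSet.image c), ?_, ?_, ?_⟩
  · rw [Submodule.span_le]
    rintro _ ⟨i, -, rfl⟩
    rw [SetLike.mem_coe, ← hsl]
    have := Γ.coact_mem k ω hω
    generalize Γ.coact ω = x at this
    induction this using Submodule.span_induction with
    | mem x hx =>
      obtain ⟨a, w, hw, rfl⟩ := hx
      simpa using Submodule.smul_mem _ _ hw
    | zero => simp
    | add x y _ _ hx hy => rw [map_add]; exact add_mem hx hy
    | smul c x _ hx => rw [map_smul]; exact Submodule.smul_mem _ _ hx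
  · rw [← Γ.coact_counit ω, ← hc, Finsupp.sum]
    simp only [map_sum, TensorProduct.map_tmul, LinearMap.id_apply, TensorProduct.lid_tmul]
    exact Submodule.sum_mem _ fun i hi => Submodule.smul_mem _ _ (Submodule.subset_span ⟨i, hi, rfl⟩)
  · intro η hη
    induction hη using Submodule.span_induction with
    | mem x hx =>
      obtain ⟨i, -, rfl⟩ := hx
      have h1 : Γ.coact (c i) = leftSlice (b.coord i)
          (TensorProduct.map LinearMap.id Γ.coact.toLinearMap (Γ.coact ω)) := by
        rw [← hsl]
        induction Γ.coact ω using TensorProduct.induction_on with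
        | zero => simp
        | tmul a b => simp
        | add a b ha hb => simp only [map_add, ha, hb]
      have h2 : ∀ (x : A ⊗[ℂ] A) (w : Ω), leftSlice (b.coord i) (TensorProduct.assoc ℂ A A Ω (x ⊗ₜ w)) =
          leftSlice (b.coord i) x ⊗ₜ w := by
        intro x w
        induction x using TensorProduct.induction_on with
        | zero => simp
        | tmul a b => simp [TensorProduct.smul_tmul']
        | add a b ha hb => simp only [map_add, TensorProduct.add_tmul, ha, hb]
      rw [h1, ← Γ.coact_coassoc, ← hc, Finsupp.sum]
      simp only [map_sum, TensorProduct.map_tmul, LinearMap.id_apply, h2]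
      exact Submodule.sum_mem _ fun j hj =>
        tmul_mem_tensorSubmodule _ (Submodule.subset_span ⟨j, hj, rfl⟩)
    | zero => simp
    | add x y _ _ hx hy => rw [map_add]; exact add_mem hx hy
    | smul c x _ hx => rw [map_smul]; exact Submodule.smul_mem _ _ hx

theorem exists_orthonormalSubcomodule (ip : InnerProductSpace.Core ℂ Ω) (k : ℕ) {ω : Ω}
    (hω : ω ∈ Γ.form k) :
    ∃ (n : ℕ) (v : Fin n → Ω) (u : Matrix (Fin n) (Fin n) A),
      Γ.IsOrthonormalSubcomodule ip v u ∧ (∀ j, v j ∈ Γ.form k) ∧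
      ω ∈ Submodule.span ℂ (Set.range v) := by
  obtain ⟨V, hfd, hk, hmem, hV⟩ := Γ.exists_finiteDimensional_subcomodule k hω
  obtain ⟨n, v, hv, rfl⟩ := exists_orthonormal_span_eq ip V
  have hvV : ∀ j, v j ∈ Submodule.span ℂ (Set.range v) := fun j => Submodule.subset_span ⟨j, rfl⟩
  exact ⟨n, v, fun j k => slice (ipLeft ip (v k)) (Γ.coact (v j)),
    ⟨hv, fun j => eq_sum_slice ip hv (hV _ (hvV j))⟩, fun j => hk (hvV j), hmem⟩

namespace IsOrthonormalSubcomodule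

variable {Γ} {ip : InnerProductSpace.Core ℂ Ω} {n : ℕ} {v : Fin n → Ω}
  {u : Matrix (Fin n) (Fin n) A} (hv : Γ.IsOrthonormalSubcomodule ip v u)
include hv

theorem slice_coact (j k : Fin n) : slice (ipLeft ip (v k)) (Γ.coact (v j)) = u j k := by
  simp [hv.coact_eq, hv.orthonormal]

theorem isCorepMatrix : IsCorepMatrix u where
  comul j l := by
    have h1 : ∀ x : A ⊗[ℂ] Ω, Coalgebra.comul (R := ℂ) (slice (ipLeft ip (v l)) x) =
        TensorProduct.map LinearMap.id (slice (ipLeft ip (v l)))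
          (TensorProduct.assoc ℂ A A Ω (TensorProduct.map Coalgebra.comul LinearMap.id x)) := by
      intro x
      induction x using TensorProduct.induction_on with
      | zero => simp
      | tmul a w =>
        simp only [slice_tmul, map_smul, TensorProduct.map_tmul, LinearMap.id_apply]
        induction Coalgebra.comul (R := ℂ) a using TensorProduct.induction_on with
        | zero => simp
        | tmul a b => simp
        | add a b ha hb => simp only [map_add, smul_add, TensorProduct.add_tmul, ha, hb]
      | add a b ha hb => simp only [map_add, ha, hb]
    rw [← hv.slice_coact, h1, Γ.coact_coassoc, hv.coact_eq]
    simp [hv.slice_coact]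
  counit j l := by
    have h1 : ∀ x : A ⊗[ℂ] Ω, Coalgebra.counit (R := ℂ) (slice (ipLeft ip (v l)) x) =
        ipLeft ip (v l)
          (TensorProduct.lid ℂ Ω (TensorProduct.map Coalgebra.counit LinearMap.id x)) := by
      intro x
      induction x using TensorProduct.induction_on with
      | zero => simp
      | tmul a w => simp [mul_comm]
      | add a b ha hb => simp only [map_add, ha, hb]
    rw [← hv.slice_coact, h1, Γ.coact_counit, ipLeft_apply, hv.orthonormal]

/-- The invariant forms `S(u) v`. -/
theorem sum_antipode_mem_inv (k : Fin n) :
    ∑ l, Γ.ι (HopfAlgebra.antipode ℂ (u k l)) * v l ∈ Γ.inv := by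
  have hu := hv.isCorepMatrix
  rw [mem_inv]
  simp only [map_sum, map_mul, Γ.coact_ι, hu.comul_antipode, hv.coact_eq, TensorProduct.map_tmul,
    Finset.sum_mul, Finset.mul_sum, Algebra.TensorProduct.tmul_mul_tmul, LinearMap.id_apply,
    AlgHom.toLinearMap_apply, TensorProduct.tmul_sum]
  have h1 : ∀ i j, ∑ l, HopfAlgebra.antipode ℂ (u i l) * u l j = if i = j then 1 else 0 :=
    hu.sum_antipode_mul
  rw [Finset.sum_comm]
  conv_lhs =>
    enter [2, y]
    rw [Finset.sum_comm]
    simp only [← TensorProduct.sum_tmul, h1]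
  rw [Finset.sum_comm]
  refine Finset.sum_congr rfl fun l _ => ?_
  rw [Finset.sum_eq_single l] <;> simp +contextual [eq_comm]

theorem eq_sum_mul_inv (j : Fin n) :
    v j = ∑ k, Γ.ι (u j k) * ∑ l, Γ.ι (HopfAlgebra.antipode ℂ (u k l)) * v l := by
  simp only [Finset.mul_sum, ← mul_assoc, ← map_mul]
  rw [Finset.sum_comm]
  simp only [← Finset.sum_mul, ← map_sum, hv.isCorepMatrix.sum_mul_antipode]
  rw [Finset.sum_eq_single j] <;> simp +contextual [eq_comm]

end IsOrthonormalSubcomodule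

end Subcomodule

section Structure

variable (ip : InnerProductSpace.Core ℂ Ω)
include Γ ip

/-- Beyond the Hopf-module statement `Ω_k = A · Ω_k^inv`, it matters that the coefficients are
slices of `Δ_Ω(ω)`: they stay in any subspace of `A` that contains those slices. -/
theorem exists_eq_sum_slice_mul_inv (k : ℕ) {ω : Ω} (hω : ω ∈ Γ.form k) :
    ∃ (n : ℕ) (φ : Fin n → (Ω →ₗ[ℂ] ℂ)) (w : Fin n → Ω), (∀ j, w j ∈ Γ.invForm k) ∧
      ω = ∑ j, Γ.ι (slice (φ j) (Γ.coact ω)) * w j := by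
  obtain ⟨n, v, u, hv, hk, hmem⟩ := Γ.exists_orthonormalSubcomodule ip k hω
  refine ⟨n, fun j => ipLeft ip (v j),
    fun j => ∑ l, Γ.ι (HopfAlgebra.antipode ℂ (u j l)) * v l, fun j =>
      ⟨Submodule.sum_mem _ fun l _ => Γ.ι_mul_mem _ (hk l), hv.sum_antipode_mem_inv j⟩, ?_⟩
  clear hω
  induction hmem using Submodule.span_induction with
  | mem x hx =>
    obtain ⟨j, rfl⟩ := hx
    simp only [hv.slice_coact]
    exact hv.eq_sum_mul_inv j
  | zero => simp
  | add x y _ _ hx hy =>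
    simp only [map_add, add_mul, Finset.sum_add_distrib]
    rw [← hx, ← hy]
  | smul c x _ hx =>
    simp only [map_smul, smul_mul_assoc, ← Finset.smul_sum]
    rw [← hx]

theorem form_eq_span_inv (k : ℕ) :
    Γ.form k = Submodule.span ℂ {ω | ∃ (a : A) (η : Ω), η ∈ Γ.invForm k ∧ ω = Γ.ι a * η} := by
  apply le_antisymm
  · intro ω hω
    obtain ⟨n, φ, w, hw, h⟩ := Γ.exists_eq_sum_slice_mul_inv ip k hω
    rw [h]
    exact Submodule.sum_mem _ fun j _ => Submodule.subset_span ⟨_, _, hw j, rfl⟩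
  · rw [Submodule.span_le]
    rintro _ ⟨a, η, hη, rfl⟩
    exact Γ.ι_mul_mem a hη.1

/-- Induction over `k`-forms as combinations of products `aη` with `η` invariant. -/
theorem inv_induction {k : ℕ} {p : Ω → Prop} (mem : ∀ (a : A), ∀ η ∈ Γ.invForm k, p (Γ.ι a * η))
    (add : ∀ ω η, p ω → p η → p (ω + η)) {ω : Ω} (hω : ω ∈ Γ.form k) : p ω := by
  rw [Γ.form_eq_span_inv ip k] at hω
  have hsmul : ∀ (c : ℂ), ∀ x ∈ {ω | ∃ (a : A) (η : Ω), η ∈ Γ.invForm k ∧ ω = Γ.ι a * η},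
      p (c • x) := by
    rintro c _ ⟨a, η, hη, rfl⟩
    rw [← smul_mul_assoc, ← map_smul]
    exact mem _ _ hη
  refine Submodule.closure_induction (p := fun x _ => p x) ?_ ?_ ?_ hω
  · simpa using mem 0 0 (zero_mem _)
  · intro x y _ _; exact add x y
  · intro c x hx; exact hsmul c x hx

theorem exists_corepMatrix (a : A) : ∃ (n : ℕ) (u : Matrix (Fin n) (Fin n) A),
    IsCorepMatrix u ∧ a ∈ Submodule.span ℂ (Set.range fun p : Fin n × Fin n => u p.1 p.2) := by
  obtain ⟨n, v, u, hv, hk, hmem⟩ := Γ.exists_orthonormalSubcomodule ip 0 (Γ.ι_mem a)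
  obtain ⟨g, hg⟩ := LinearMap.exists_leftInverse_of_injective Γ.ι.toLinearMap
    (LinearMap.ker_eq_bot.2 Γ.ι_injective)
  refine ⟨n, u, hv.isCorepMatrix, ?_⟩
  -- The counit law `a = (id ⊗ ε) Δ(a)`, with `g` extending the inverse of `ι` to all of `Ω` so that
  -- `ε` can be applied to the second leg of `Δ_Ω`.
  have h1 : a = slice (Coalgebra.counit ∘ₗ g) (Γ.coact (Γ.ι a)) := by
    have h2 : ∀ x : A ⊗[ℂ] A, slice (Coalgebra.counit ∘ₗ g)
        (TensorProduct.map LinearMap.id Γ.ι.toLinearMap x) =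
        TensorProduct.rid ℂ A (Coalgebra.counit.lTensor A x) := by
      intro x
      induction x using TensorProduct.induction_on with
      | zero => simp
      | tmul a w =>
        have := LinearMap.congr_fun hg w
        simp only [LinearMap.comp_apply, AlgHom.toLinearMap_apply, LinearMap.id_apply] at this
        simp [this]
      | add a b ha hb => simp only [map_add, ha, hb]
    rw [Γ.coact_ι, h2, Coalgebra.lTensor_counit_comul]
    simp
  rw [h1]
  generalize Γ.ι a = ω at hmem
  induction hmem using Submodule.span_induction with
  | mem x hx =>
    obtain ⟨j, rfl⟩ := hx
    rw [hv.coact_eq, map_sum]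
    simp only [slice_tmul]
    exact Submodule.sum_mem _ fun k _ =>
      Submodule.smul_mem _ _ (Submodule.subset_span ⟨(j, k), rfl⟩)
  | zero => simp
  | add x y _ _ hx hy => simp only [map_add]; exact add_mem hx hy
  | smul c x _ hx => simp only [map_smul]; exact Submodule.smul_mem _ _ hx

theorem exists_modular {h : A →ₗ[ℂ] ℂ} (hh : IsHaarIntegral h) (b : A) :
    ∃ c : A, ∀ x : A, h (x * b) = h (c * x) := by
  obtain ⟨n, u, hu, hb⟩ := Γ.exists_corepMatrix ip b
  induction hb using Submodule.span_induction with
  | mem x hx =>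
    obtain ⟨⟨i, j⟩, rfl⟩ := hx
    exact hh.exists_modular_coeff hu i j
  | zero => exact ⟨0, by simp⟩
  | add x y _ _ hx hy =>
    obtain ⟨c, hc⟩ := hx
    obtain ⟨c', hc'⟩ := hy
    exact ⟨c + c', fun x => by simp [mul_add, add_mul, hc, hc']⟩
  | smul t x _ hx =>
    obtain ⟨c, hc⟩ := hx
    exact ⟨t • c, fun x => by simp [hc]⟩

theorem antipode_star_antipode_star [StarModule ℂ A] [HopfStarAlgebra A] (a : A) :
    HopfAlgebra.antipode ℂ (star (HopfAlgebra.antipode ℂ (star a))) = a := by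
  obtain ⟨n, u, hu, ha⟩ := Γ.exists_corepMatrix ip a
  induction ha using Submodule.span_induction with
  | mem x hx =>
    obtain ⟨⟨i, j⟩, rfl⟩ := hx
    exact hu.antipode_star_antipode_star i j
  | zero => simp
  | add x y _ _ hx hy => simp [hx, hy]
  | smul t x _ hx => simp [hx]

theorem antipode_injective [StarModule ℂ A] [HopfStarAlgebra A] :
    Function.Injective (HopfAlgebra.antipode ℂ (A := A)) := by
  apply Function.LeftInverse.injective (g := fun a => star (HopfAlgebra.antipode ℂ (star a)))
  intro a
  apply star_injective
  simpa using Γ.antipode_star_antipode_star ip (star a)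

end Structure

end StarDifferentialCalculus

/-! ### The integral: invariance, closedness, non-degeneracy. -/

namespace StarDifferentialCalculus

variable {A Ω : Type*} [Ring A] [HopfAlgebra ℂ A] [StarRing A]
  [Ring Ω] [Algebra ℂ Ω] [StarAddMonoid Ω] (Γ : StarDifferentialCalculus A Ω)

/-- The standing assumptions: an `N`-dimensional non-degenerate calculus with a left-invariant
inner product and a volume element. -/
structure IsOriented (h : A →ₗ[ℂ] ℂ) (N : ℕ) (ip : InnerProductSpace.Core ℂ Ω) (θ : Ω) :
    Prop where
  haar : IsHaarIntegral h
  finite : FiniteDimensional ℂ Γ.inv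
  dim : Γ.HasDimension N
  top : Module.finrank ℂ (Γ.invForm N) = 1
  closed : ∀ k : ℕ, k + 1 = N → ∀ ω ∈ Γ.invForm k, Γ.d ω = 0
  nondegenerate : Γ.Nondegenerate N
  graded : Γ.IsGraded ip
  leftInvariant : Γ.IsLeftInvariant h ip
  volume : Γ.IsVolumeElement N ip θ

variable {Γ} {h : A →ₗ[ℂ] ℂ} {N : ℕ} {ip : InnerProductSpace.Core ℂ Ω} {θ : Ω}

namespace IsOriented

variable (H : Γ.IsOriented h N ip θ)
include H

theorem haar_eq_ipForm (a b : A) : ipForm ip (Γ.ι a * θ) (Γ.ι b * θ) = h (star b * a) := by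
  rw [H.leftInvariant a b θ H.volume.1.2 θ H.volume.1.2, H.volume.2.2, mul_one]

theorem haar_star (a : A) : h (star a) = conj (h a) := by
  have h1 := H.haar_eq_ipForm a 1
  have h2 := H.haar_eq_ipForm 1 a
  rw [mul_one] at h2
  rw [← h2, ← ipForm_conj, h1, star_one, one_mul]

theorem ι_mul_volume_injective {a : A} (ha : Γ.ι a * θ = 0) : a = 0 := by
  have h1 : ∀ b, h (star b * a) = 0 := fun b => by
    rw [← H.haar_eq_ipForm, ha, ipForm_zero_left]
  have h2 := H.leftInvariant a a 1 (by simp [mem_inv]; rfl) 1 (by simp [mem_inv]; rfl)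
  rw [h1, zero_mul, mul_one] at h2
  exact Γ.ι_injective ((ipForm_definite ip h2).trans (map_zero _).symm)

/-- Taking `x = b^*` makes `bθ` a vector of norm zero; faithfulness of `h` is thus inherited from
definiteness of the inner product. -/
theorem haar_faithful {b : A} (hb : ∀ x, h (x * b) = 0) : b = 0 := by
  apply H.ι_mul_volume_injective
  apply ipForm_definite ip
  rw [H.haar_eq_ipForm, hb]

theorem volume_ne_zero : θ ≠ 0 := by
  rintro rfl
  simpa using H.volume.2.2

theorem exists_eq_ι_mul_volume {ω : Ω} (hω : ω ∈ Γ.form N) : ∃ a, ω = Γ.ι a * θ := by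
  refine Γ.inv_induction ip (p := fun ω => ∃ a, ω = Γ.ι a * θ) (fun a η hη => ?_) ?_ hω
  · obtain ⟨c, hc⟩ := (finrank_eq_one_iff_of_nonzero' (⟨θ, H.volume.1⟩ : Γ.invForm N)
      (by simpa [Subtype.ext_iff] using H.volume_ne_zero)).1 H.top ⟨η, hη⟩
    have hc' : c • θ = η := congr_arg Subtype.val hc
    exact ⟨c • a, by rw [← hc']; simp⟩
  · rintro _ _ ⟨a, rfl⟩ ⟨b, rfl⟩
    exact ⟨a + b, by simp [add_mul]⟩

theorem isIntegral_ipLeft : Γ.IsIntegral h N θ (ipLeft ip θ) := by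
  refine ⟨fun k hk ω hω => H.graded k N hk.ne ω hω θ H.volume.1.1, fun a => ?_⟩
  have := H.haar_eq_ipForm a 1
  simpa using this

theorem form_eq_zero {k : ℕ} (hk : N < k) {ω : Ω} (hω : ω ∈ Γ.form k) : ω = 0 := by
  rwa [H.dim.2 k hk, Submodule.mem_bot] at hω

section Integral

variable {J : Ω →ₗ[ℂ] ℂ} (hJ : Γ.IsIntegral h N θ J)
include hJ

theorem integral_eq_zero {k : ℕ} (hk : k ≠ N) {ω : Ω} (hω : ω ∈ Γ.form k) : J ω = 0 := by
  rcases lt_or_gt_of_ne hk with hk | hk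
  · exact hJ.1 k hk ω hω
  · rw [H.form_eq_zero hk hω, map_zero]

theorem integral_eq_ipLeft : J = ipLeft ip θ := by
  refine Γ.hom_ext fun k ω hω => ?_
  by_cases hk : k = N
  · subst hk
    obtain ⟨a, rfl⟩ := H.exists_eq_ι_mul_volume hω
    rw [hJ.2, H.isIntegral_ipLeft.2]
  · rw [H.integral_eq_zero hJ hk hω, H.integral_eq_zero H.isIntegral_ipLeft hk hω]

theorem slice_coact (ω : Ω) : slice J (Γ.coact ω) = J ω • (1 : A) := by
  refine Γ.homogeneous_induction ω (fun k ω hω => ?_) fun ω η h1 h2 => by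
    simp only [map_add, h1, h2, add_smul]
  by_cases hk : k = N
  · subst hk
    obtain ⟨a, rfl⟩ := H.exists_eq_ι_mul_volume hω
    rw [hJ.2, ← H.haar.right_inv, map_mul, Γ.coact_ι, Γ.mem_inv.1 H.volume.1.2]
    induction Coalgebra.comul (R := ℂ) a using TensorProduct.induction_on with
    | zero => simp
    | tmul a b => simp [hJ.2]
    | add a b ha hb => simp only [map_add, add_mul, ha, hb]
  · rw [H.integral_eq_zero hJ hk hω, zero_smul]
    have := Γ.coact_mem k ω hω
    generalize Γ.coact ω = x at this
    induction this using Submodule.span_induction with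
    | mem x hx =>
      obtain ⟨a, w, hw, rfl⟩ := hx
      simp [H.integral_eq_zero hJ hk hw]
    | zero => simp
    | add x y _ _ hx hy => rw [map_add, hx, hy, add_zero]
    | smul c x _ hx => rw [map_smul, hx, smul_zero]

/-- If `coact ∘ f = (id ⊗ f) Δ`, then `J ∘ f` is a multiple of the Haar integral. -/
theorem integral_equivariant (f : A →ₗ[ℂ] Ω)
    (hf : ∀ a, Γ.coact (f a) = TensorProduct.map LinearMap.id f (Coalgebra.comul (R := ℂ) a))
    (a : A) : J (f a) = h a * J (f 1) := by
  refine H.haar.eq_smul_of_left_invariant (J ∘ₗ f) (fun a => ?_) a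
  rw [LinearMap.comp_apply, ← H.slice_coact hJ, hf]
  induction Coalgebra.comul (R := ℂ) a using TensorProduct.induction_on with
  | zero => simp
  | tmul a b => simp
  | add a b ha hb => simp only [map_add, ha, hb]

theorem integral_mul_ι_mul {ω η : Ω} (hω : ω ∈ Γ.inv) (hη : η ∈ Γ.inv) (a : A) :
    J (ω * Γ.ι a * η) = h a * J (ω * η) := by
  have := H.integral_equivariant hJ
    (LinearMap.mulRight ℂ η ∘ₗ LinearMap.mulLeft ℂ ω ∘ₗ Γ.ι.toLinearMap) (fun a => ?_) a
  · simpa using this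
  · simp only [LinearMap.comp_apply, LinearMap.mulRight_apply, LinearMap.mulLeft_apply,
      AlgHom.toLinearMap_apply, map_mul, Γ.coact_ι, Γ.mem_inv.1 hω, Γ.mem_inv.1 hη]
    induction Coalgebra.comul (R := ℂ) a using TensorProduct.induction_on with
    | zero => simp
    | tmul a b => simp
    | add a b ha hb => simp only [map_add, mul_add, add_mul, ha, hb]

theorem integral_star (ω : Ω) : J (star ω) = conj (J ω) := by
  refine Γ.homogeneous_induction ω (fun k ω hω => ?_) fun ω η h1 h2 => by
    rw [star_add, map_add, map_add, map_add, h1, h2]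
  by_cases hk : k = N
  · subst hk
    obtain ⟨a, rfl⟩ := H.exists_eq_ι_mul_volume hω
    have hone : (1 : Ω) ∈ Γ.inv := by simp [mem_inv]; rfl
    have hθ : J θ = 1 := by simpa [H.haar.map_one] using hJ.2 1
    rw [Γ.star_mul 0 k _ _ (Γ.ι_mem a) H.volume.1.1, H.volume.2.1, ← Γ.ι_star]
    have := H.integral_mul_ι_mul hJ H.volume.1.2 hone (star a)
    rw [mul_one, mul_one, hθ, mul_one] at this
    simp [this, H.haar_star, hJ.2]
  · rw [H.integral_eq_zero hJ hk hω, H.integral_eq_zero hJ hk (Γ.star_mem k ω hω), map_zero]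

/-- Only `(N-1)`-forms `aη` with `η` invariant matter. As `dη = 0`, the functional `a ↦ ∫ (da)η` is
left-invariant, hence a multiple of `h` with factor `∫ (d1)η = 0`. -/
theorem integral_d (ω : Ω) : J (Γ.d ω) = 0 := by
  refine Γ.homogeneous_induction ω (fun k ω hω => ?_) fun ω η h1 h2 => by
    rw [map_add, map_add, h1, h2, add_zero]
  by_cases hk : k + 1 = N
  · refine Γ.inv_induction ip (p := fun ω => J (Γ.d ω) = 0) (fun a η hη => ?_)
      (fun ω η h1 h2 => by rw [map_add, map_add, h1, h2, add_zero]) hω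
    · have hd : Γ.d (Γ.ι a * η) = Γ.d (Γ.ι a) * η := by
        rw [Γ.d_mul 0 _ _ (Γ.ι_mem a), H.closed k hk η hη]; simp
      have := H.integral_equivariant hJ
        (LinearMap.mulRight ℂ η ∘ₗ Γ.d ∘ₗ Γ.ι.toLinearMap) (fun a => ?_) a
      · rw [hd]
        simpa [Γ.d_one] using this
      · simp only [LinearMap.comp_apply, LinearMap.mulRight_apply,
          AlgHom.toLinearMap_apply, map_mul, Γ.coact_d, Γ.coact_ι, Γ.mem_inv.1 hη.2]
        induction Coalgebra.comul (R := ℂ) a using TensorProduct.induction_on with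
        | zero => simp
        | tmul a b => simp
        | add a b ha hb => simp only [map_add, add_mul, ha, hb]
  · exact H.integral_eq_zero hJ hk (Γ.d_mem k ω hω)

/-- Write `ω'ω = bθ`. Replacing `ω'` by `xω'` gives `h(xb) = 0` for all `x`, so `b = 0` and
non-degeneracy of the calculus applies. -/
theorem eq_zero_of_integral_mul_eq_zero {k : ℕ} {ω : Ω} (hω : ω ∈ Γ.form k)
    (h0 : ∀ ω' ∈ Γ.form (N - k), J (ω' * ω) = 0) : ω = 0 := by
  rcases lt_or_ge N k with hk | hk
  · exact H.form_eq_zero hk hω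
  refine H.nondegenerate k hk ω hω fun ω' hω' => ?_
  have hm := Γ.mul_mem _ _ _ _ hω' hω
  rw [Nat.sub_add_cancel hk] at hm
  obtain ⟨b, hb⟩ := H.exists_eq_ι_mul_volume hm
  have hb0 : b = 0 := H.haar_faithful fun x => by
    rw [← hJ.2, map_mul Γ.ι, mul_assoc, ← hb, ← mul_assoc]
    exact h0 _ (Γ.ι_mul_mem x hω')
  rw [hb, hb0, map_zero, zero_mul]

theorem eq_zero_of_integral_mul_eq_zero' {k : ℕ} {ω : Ω} (hω : ω ∈ Γ.form k)
    (h0 : ∀ ω' ∈ Γ.form (N - k), J (ω * ω') = 0) : ω = 0 := by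
  rw [← star_eq_zero]
  refine H.eq_zero_of_integral_mul_eq_zero hJ (Γ.star_mem k ω hω) fun ω' hω' => ?_
  have h1 := h0 _ (Γ.star_mem _ _ hω')
  have h2 := H.integral_star hJ (ω * star ω')
  rw [h1, map_zero, Γ.star_mul k (N - k) _ _ hω (Γ.star_mem _ _ hω'), star_star, map_smul,
    smul_eq_mul, mul_eq_zero] at h2
  exact h2.resolve_left (by simp)

theorem integral_proj_mul {k l : ℕ} (hkl : k + l = N) (ω : Ω) {ω' : Ω} (hω' : ω' ∈ Γ.form l) :
    J (Γ.proj k ω * ω') = J (ω * ω') := by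
  refine Γ.homogeneous_induction ω (fun m ω hω => ?_) fun ω η h1 h2 => by
    simp only [map_add, add_mul, h1, h2]
  by_cases hm : m = k
  · subst hm; rw [Γ.proj_of_mem hω]
  · rw [Γ.proj_of_ne hm hω, zero_mul, map_zero,
      H.integral_eq_zero hJ (by omega) (Γ.mul_mem m l _ _ hω hω')]

theorem integral_mul_proj {k l : ℕ} (hkl : l + k = N) (ω : Ω) {ω' : Ω} (hω' : ω' ∈ Γ.form l) :
    J (ω' * Γ.proj k ω) = J (ω' * ω) := by
  refine Γ.homogeneous_induction ω (fun m ω hω => ?_) fun ω η h1 h2 => by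
    simp only [map_add, mul_add, h1, h2]
  by_cases hm : m = k
  · subst hm; rw [Γ.proj_of_mem hω]
  · rw [Γ.proj_of_ne hm hω, mul_zero, map_zero,
      H.integral_eq_zero hJ (by omega) (Γ.mul_mem l m _ _ hω' hω)]

theorem eq_of_integral_mul_eq {ω η : Ω} (h0 : ∀ ω', J (ω' * ω) = J (ω' * η)) : ω = η := by
  refine Γ.eq_of_proj_eq fun k => ?_
  rcases lt_or_ge N k with hk | hk
  · rw [H.form_eq_zero hk (Γ.proj_mem k ω), H.form_eq_zero hk (Γ.proj_mem k η)]
  rw [← sub_eq_zero, ← map_sub]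
  refine H.eq_zero_of_integral_mul_eq_zero hJ (Γ.proj_mem k _) fun ω' hω' => ?_
  rw [H.integral_mul_proj hJ (by omega) _ hω', mul_sub, map_sub, h0, sub_self]

theorem eq_of_integral_mul_eq' {ω η : Ω} (h0 : ∀ ω', J (ω * ω') = J (η * ω')) : ω = η := by
  refine Γ.eq_of_proj_eq fun k => ?_
  rcases lt_or_ge N k with hk | hk
  · rw [H.form_eq_zero hk (Γ.proj_mem k ω), H.form_eq_zero hk (Γ.proj_mem k η)]
  rw [← sub_eq_zero, ← map_sub]
  refine H.eq_zero_of_integral_mul_eq_zero' hJ (Γ.proj_mem k _) fun ω' hω' => ?_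
  rw [H.integral_proj_mul hJ (by omega) _ hω', sub_mul, map_sub, h0, sub_self]

end Integral

theorem existsUnique_integral : ∃! J : Ω →ₗ[ℂ] ℂ, Γ.IsIntegral h N θ J :=
  ⟨ipLeft ip θ, H.isIntegral_ipLeft, fun _ hJ => H.integral_eq_ipLeft hJ⟩

end IsOriented

end StarDifferentialCalculus

theorem neg_one_pow_mul_self (n : ℕ) : (-1 : ℂ) ^ n * (-1) ^ n = 1 := by
  rw [← mul_pow]; norm_num

/-! ### The twist automorphism. -/

namespace StarDifferentialCalculus

variable {A Ω : Type*} [Ring A] [HopfAlgebra ℂ A] [StarRing A]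
  [Ring Ω] [Algebra ℂ Ω] [StarAddMonoid Ω] (Γ : StarDifferentialCalculus A Ω)

/-- `τ` is a twist of the `k`-form `ω` with respect to `J`. -/
structure IsTwist (J : Ω →ₗ[ℂ] ℂ) (k : ℕ) (ω τ : Ω) : Prop where
  left_mem : ω ∈ Γ.form k
  right_mem : τ ∈ Γ.form k
  twist : ∀ l, ∀ ω' ∈ Γ.form l, J (ω' * ω) = (-1 : ℂ) ^ (k * l) * J (τ * ω')

variable {Γ} {h : A →ₗ[ℂ] ℂ} {N : ℕ} {ip : InnerProductSpace.Core ℂ Ω} {θ : Ω}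
  {J : Ω →ₗ[ℂ] ℂ}

namespace IsTwist

variable {k l : ℕ} {ω η τ ρ : Ω}

theorem zero : Γ.IsTwist J k 0 0 := ⟨zero_mem _, zero_mem _, by simp⟩

theorem add (h1 : Γ.IsTwist J k ω τ) (h2 : Γ.IsTwist J k η ρ) :
    Γ.IsTwist J k (ω + η) (τ + ρ) :=
  ⟨add_mem h1.1 h2.1, add_mem h1.2 h2.2, fun l ω' hω' => by
    rw [mul_add, add_mul, map_add, map_add, h1.3 l ω' hω', h2.3 l ω' hω', mul_add]⟩

theorem smul (c : ℂ) (h1 : Γ.IsTwist J k ω τ) : Γ.IsTwist J k (c • ω) (c • τ) :=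
  ⟨Submodule.smul_mem _ _ h1.1, Submodule.smul_mem _ _ h1.2, fun l ω' hω' => by
    rw [mul_smul_comm, smul_mul_assoc, map_smul, map_smul, h1.3 l ω' hω', smul_eq_mul,
      smul_eq_mul, mul_left_comm]⟩

theorem mul (h1 : Γ.IsTwist J k ω τ) (h2 : Γ.IsTwist J l η ρ) :
    Γ.IsTwist J (k + l) (ω * η) (τ * ρ) := by
  refine ⟨Γ.mul_mem _ _ _ _ h1.1 h2.1, Γ.mul_mem _ _ _ _ h1.2 h2.2, fun m ω' hω' => ?_⟩
  rw [← mul_assoc, h2.3 _ _ (Γ.mul_mem _ _ _ _ hω' h1.1), ← mul_assoc,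
    h1.3 _ _ (Γ.mul_mem _ _ _ _ h2.2 hω'), ← mul_assoc, ← mul_assoc, ← pow_add]
  congr 1
  have : l * (m + k) + k * (l + m) = (k + l) * m + (k * l + k * l) := by ring
  rw [this, pow_add, pow_add _ (k * l), neg_one_pow_mul_self, mul_one]

/-- Integration by parts on both sides: `∫ d(ω'ω) = 0` and `∫ d(τω') = 0`, linked by the twist
relation for `ω` against `dω'`. -/
theorem d (H : Γ.IsOriented h N ip θ) (hJ : Γ.IsIntegral h N θ J) (h1 : Γ.IsTwist J k ω τ) :
    Γ.IsTwist J (k + 1) (Γ.d ω) (Γ.d τ) := by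
  refine ⟨Γ.d_mem _ _ h1.1, Γ.d_mem _ _ h1.2, fun l ω' hω' => ?_⟩
  have e1 := H.integral_d hJ (ω' * ω)
  have e2 := H.integral_d hJ (τ * ω')
  rw [Γ.d_mul l _ _ hω', map_add, map_smul, smul_eq_mul, h1.3 _ _ (Γ.d_mem _ _ hω')] at e1
  rw [Γ.d_mul k _ _ h1.2, map_add, map_smul, smul_eq_mul] at e2
  have hl := neg_one_pow_mul_self l
  have hk := neg_one_pow_mul_self k
  have e3 : J (Γ.d τ * ω') = -((-1) ^ k * J (τ * Γ.d ω')) := by linear_combination e2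
  rw [e3, add_mul, one_mul, pow_add]
  rw [mul_add, mul_one, pow_add] at e1
  linear_combination (-1) ^ l * e1 - J (ω' * Γ.d ω) * hl

/-- Conjugating the twist relation reverses the products and so exchanges the two roles. This is the
source of `σ(σ(ω)^*) = ω^*`. -/
theorem star (H : Γ.IsOriented h N ip θ) (hJ : Γ.IsIntegral h N θ J) (h1 : Γ.IsTwist J k ω τ) :
    Γ.IsTwist J k (star τ) (star ω) := by
  refine ⟨Γ.star_mem _ _ h1.2, Γ.star_mem _ _ h1.1, fun l ω' hω' => ?_⟩
  have hs := Γ.star_mem _ _ hω'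
  have e1 := h1.3 l _ hs
  have e2 := H.integral_star hJ (τ * Star.star ω')
  have e3 := H.integral_star hJ (Star.star ω' * ω)
  rw [Γ.star_mul k l _ _ h1.2 hs, star_star, map_smul, smul_eq_mul] at e2
  rw [Γ.star_mul l k _ _ hs h1.1, star_star, map_smul, smul_eq_mul, mul_comm l k, e1,
    map_mul (starRingEnd ℂ)] at e3
  simp only [map_pow, map_neg, map_one] at e3
  have hkl := neg_one_pow_mul_self (k * l)
  linear_combination (-1) ^ (k * l) * e2 - e3 - J (ω' * Star.star τ) * hkl

theorem unique (H : Γ.IsOriented h N ip θ) (hJ : Γ.IsIntegral h N θ J) (h1 : Γ.IsTwist J k ω τ)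
    (h2 : Γ.IsTwist J k ω ρ) : τ = ρ := by
  rw [← sub_eq_zero]
  refine H.eq_zero_of_integral_mul_eq_zero' hJ (sub_mem h1.2 h2.2) fun ω' hω' => ?_
  have := (h1.3 _ _ hω').symm.trans (h2.3 _ _ hω')
  rw [sub_mul, map_sub, sub_eq_zero]
  exact mul_left_cancel₀ (by simp) this

/-- If `θa = bθ`, then `∫ (xθ)a = h(xb) = h(cx) = ∫ c(xθ)`, with `c` given by the modular property
of `h`. -/
theorem exists_ι (H : Γ.IsOriented h N ip θ) (hJ : Γ.IsIntegral h N θ J) (a : A) :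
    ∃ τ, Γ.IsTwist J 0 (Γ.ι a) τ := by
  obtain ⟨b, hb⟩ := H.exists_eq_ι_mul_volume (Γ.mul_ι_mem a H.volume.1.1)
  obtain ⟨c, hc⟩ := Γ.exists_modular ip H.haar b
  refine ⟨Γ.ι c, Γ.ι_mem _, Γ.ι_mem _, fun l ω' hω' => ?_⟩
  rw [zero_mul, pow_zero, one_mul]
  by_cases hl : l = N
  · subst hl
    obtain ⟨x, rfl⟩ := H.exists_eq_ι_mul_volume hω'
    rw [mul_assoc, hb, ← mul_assoc, ← mul_assoc, ← map_mul, ← map_mul, hJ.2, hJ.2, hc]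
  · rw [H.integral_eq_zero hJ hl (Γ.mul_ι_mem a hω'), H.integral_eq_zero hJ hl (Γ.ι_mul_mem c hω')]

theorem exists_of_mem (H : Γ.IsOriented h N ip θ) (hJ : Γ.IsIntegral h N θ J) (k : ℕ) {ω : Ω}
    (hω : ω ∈ Γ.form k) : ∃ τ, Γ.IsTwist J k ω τ := by
  refine Γ.form_induction (p := fun k ω => ∃ τ, Γ.IsTwist J k ω τ) (fun k => ⟨0, zero⟩) ?_ ?_ ?_
    (exists_ι H hJ) ?_ k ω hω
  · rintro k ω η ⟨τ, h1⟩ ⟨ρ, h2⟩; exact ⟨_, h1.add h2⟩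
  · rintro k c ω ⟨τ, h1⟩; exact ⟨_, h1.smul c⟩
  · rintro k l ω η ⟨τ, h1⟩ ⟨ρ, h2⟩; exact ⟨_, h1.mul h2⟩
  · intro a
    obtain ⟨τ, h1⟩ := exists_ι H hJ a
    exact ⟨_, h1.d H hJ⟩

end IsTwist

theorem star_ι_mul (a : A) {k : ℕ} {ω : Ω} (hω : ω ∈ Γ.form k) :
    star (Γ.ι a * ω) = star ω * Γ.ι (star a) := by
  rw [Γ.star_mul 0 k _ _ (Γ.ι_mem a) hω, Γ.ι_star]; simp

theorem IsTwistAutomorphism.isTwist {σ : Ω ≃ₐ[ℂ] Ω} (hσ : Γ.IsTwistAutomorphism J σ) {k : ℕ}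
    {ω : Ω} (hω : ω ∈ Γ.form k) : Γ.IsTwist J k ω (σ ω) :=
  ⟨hω, hσ.map_form k ω hω, fun l ω' hω' => hσ.twist k l ω hω ω' hω'⟩

theorem IsTwistAutomorphism.integral_eq {σ : Ω ≃ₐ[ℂ] Ω} (hσ : Γ.IsTwistAutomorphism J σ) (ω : Ω) : J (σ ω) = J ω := by
  refine Γ.homogeneous_induction ω (fun k ω hω => ?_) fun ω₁ ω₂ h1 h2 => by
    simp only [map_add, h1, h2]
  have := hσ.twist k 0 ω hω 1 Γ.one_mem
  simpa using this.symm

namespace IsOriented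

variable (H : Γ.IsOriented h N ip θ) (hJ : Γ.IsIntegral h N θ J)
include H hJ

theorem existsUnique_twistAutomorphism : ∃! σ : Ω ≃ₐ[ℂ] Ω, Γ.IsTwistAutomorphism J σ := by
  choose! f hf using fun k ω (hω : ω ∈ Γ.form k) => IsTwist.exists_of_mem H hJ k hω
  let s : Ω →ₗ[ℂ] Ω := Γ.glue fun k =>
    { toFun := fun ω => f k ω
      map_add' := fun ω η =>
        (hf k _ (add_mem ω.2 η.2)).unique H hJ ((hf k _ ω.2).add (hf k _ η.2))
      map_smul' := fun c ω =>
        (hf k _ (Submodule.smul_mem _ c ω.2)).unique H hJ ((hf k _ ω.2).smul c) }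
  have hs : ∀ k ω, ω ∈ Γ.form k → Γ.IsTwist J k ω (s ω) := fun k ω hω => by
    have : s ω = f k ω := Γ.glue_apply _ hω
    rw [this]
    exact hf k ω hω
  have hs1 : s 1 = 1 := (hs 0 1 Γ.one_mem).unique H hJ ⟨Γ.one_mem, Γ.one_mem, by simp⟩
  have hsm : ∀ ω η, s (ω * η) = s ω * s η := by
    intro ω η
    refine Γ.homogeneous_induction ω (fun k ω hω => ?_) fun ω₁ ω₂ h1 h2 => by
      simp only [map_add, add_mul, h1, h2]
    refine Γ.homogeneous_induction η (fun l η hη => ?_) fun ω₁ ω₂ h1 h2 => by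
      simp only [map_add, mul_add, h1, h2]
    exact (hs _ _ (Γ.mul_mem _ _ _ _ hω hη)).unique H hJ ((hs _ _ hω).mul (hs _ _ hη))
  have hstar : ∀ ω, s (star (s ω)) = star ω := by
    intro ω
    refine Γ.homogeneous_induction ω (fun k ω hω => ?_) fun ω₁ ω₂ h1 h2 => by
      simp only [map_add, star_add, h1, h2]
    have h1 := (hs k ω hω).star H hJ
    exact (hs k _ h1.1).unique H hJ h1
  -- The inverse is `ω ↦ s(ω^*)^*`, by `hstar`.
  have hbij : Function.Bijective s := by
    refine ⟨fun ω η hωη => ?_, fun ω => ⟨star (s (star ω)), by rw [hstar, star_star]⟩⟩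
    rw [← star_star ω, ← hstar ω, hωη, hstar η, star_star]
  refine ⟨AlgEquiv.ofBijective (AlgHom.ofLinearMap s hs1 hsm) hbij, ⟨?_, ?_, ?_⟩, ?_⟩
  · exact fun k ω hω => (hs k ω hω).2
  · intro ω
    change s (Γ.d ω) = Γ.d (s ω)
    refine Γ.homogeneous_induction ω (fun k ω hω => ?_) fun ω₁ ω₂ h1 h2 => by
      simp only [map_add, h1, h2]
    exact (hs _ _ (Γ.d_mem _ _ hω)).unique H hJ ((hs k ω hω).d H hJ)
  · exact fun k l ω hω ω' hω' => (hs k ω hω).3 l ω' hω'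
  · intro σ hσ
    have : σ.toLinearMap = s := Γ.hom_ext fun k ω hω =>
      (hσ.isTwist hω).unique H hJ (hs k ω hω)
    exact AlgEquiv.ext fun ω => LinearMap.congr_fun this ω

variable {σ : Ω ≃ₐ[ℂ] Ω} (hσ : Γ.IsTwistAutomorphism J σ)
include hσ

theorem twist_star_twist (ω : Ω) : σ (star (σ ω)) = star ω := by
  refine Γ.homogeneous_induction ω (fun k ω hω => ?_) fun ω₁ ω₂ h1 h2 => by
    simp only [map_add, star_add, h1, h2]
  have h1 := (hσ.isTwist hω).star H hJ
  exact (hσ.isTwist h1.1).unique H hJ h1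

end IsOriented

end StarDifferentialCalculus

theorem existsUnique_isAdjointFor {V : Type*} [AddCommGroup V] [Module ℂ V]
    (ip : InnerProductSpace.Core ℂ V) (T : V →ₗ[ℂ] V)
    (hT : ∀ η, ∃ τ, ∀ ω, ipForm ip (T ω) η = ipForm ip ω τ) :
    ∃! S : V →ₗ[ℂ] V, IsAdjointFor ip T S := by
  choose f hf using hT
  refine ⟨{ toFun := f
            map_add' := fun x y => ipForm_ext_right ip fun z => ?_
            map_smul' := fun c x => ipForm_ext_right ip fun z => ?_ }, fun ω η => hf η ω, ?_⟩
  · rw [← hf, ipForm_add_right, ipForm_add_right, hf, hf]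
  · rw [← hf, ipForm_smul_right, RingHom.id_apply, ipForm_smul_right, hf]
  · intro S hS
    exact LinearMap.ext fun η => ipForm_ext_right ip fun z => by
      rw [← hS, hf]; rfl

/-! ### The Hodge operator and the codifferential. -/

namespace StarDifferentialCalculus

variable {A Ω : Type*} [Ring A] [HopfAlgebra ℂ A] [StarRing A]
  [Ring Ω] [Algebra ℂ Ω] [StarAddMonoid Ω] [StarModule ℂ Ω] {Γ : StarDifferentialCalculus A Ω}
  {h : A →ₗ[ℂ] ℂ} {N : ℕ} {ip : InnerProductSpace.Core ℂ Ω} {θ : Ω} {J : Ω →ₗ[ℂ] ℂ}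

section

variable [StarModule ℂ A]

theorem star_mul_of_mem_tensorSubmodule {k l : ℕ} {x y : A ⊗[ℂ] Ω}
    (hx : x ∈ tensorSubmodule A (Γ.form k)) (hy : y ∈ tensorSubmodule A (Γ.form l)) :
    star (x * y) = (-1 : ℂ) ^ (k * l) • (star y * star x) := by
  induction hx using Submodule.span_induction with
  | mem x hx =>
    obtain ⟨a, ω, hω, rfl⟩ := hx
    induction hy using Submodule.span_induction with
    | mem y hy =>
      obtain ⟨b, η, hη, rfl⟩ := hy
      simp [Γ.star_mul k l ω η hω hη]
    | zero => simp
    | add x y _ _ hx hy => rw [mul_add, star_add, hx, hy, star_add, add_mul, smul_add]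
    | smul c x _ hx => rw [mul_smul_comm, star_smul, hx, star_smul, smul_mul_assoc, smul_comm]
  | zero => simp
  | add x y _ _ hx hy => rw [add_mul, star_add, hx, hy, star_add, mul_add, smul_add]
  | smul c x _ hx => rw [smul_mul_assoc, star_smul, hx, star_smul, mul_smul_comm, smul_comm]

variable [HopfStarAlgebra A]

variable (Γ) in
theorem coact_star (ω : Ω) : Γ.coact (star ω) = star (Γ.coact ω) := by
  have key : ∀ f : A →ₗ[ℂ] Ω, (∀ a, f (star a) = star (f a)) → ∀ x : A ⊗[ℂ] A,
      TensorProduct.map LinearMap.id f (star x) = star (TensorProduct.map LinearMap.id f x) := by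
    intro f hf x
    induction x using TensorProduct.induction_on with
    | zero => simp
    | tmul a b => simp [hf]
    | add a b ha hb => simp only [map_add, star_add, ha, hb]
  refine Γ.homogeneous_induction ω (fun k ω hω => ?_) fun ω η h1 h2 => by
    rw [star_add, map_add, map_add, star_add, h1, h2]
  refine (Γ.form_induction
    (p := fun k ω => ω ∈ Γ.form k ∧ Γ.coact (star ω) = star (Γ.coact ω)) ?_ ?_ ?_ ?_ ?_ ?_ k ω hω).2
  · exact fun k => ⟨zero_mem _, by simp⟩
  · rintro k ω η ⟨hω, h1⟩ ⟨hη, h2⟩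
    exact ⟨add_mem hω hη, by simp [h1, h2]⟩
  · rintro k c ω ⟨hω, h1⟩
    exact ⟨Submodule.smul_mem _ _ hω, by simp [h1]⟩
  · rintro k l ω η ⟨hω, h1⟩ ⟨hη, h2⟩
    refine ⟨Γ.mul_mem _ _ _ _ hω hη, ?_⟩
    rw [Γ.star_mul k l _ _ hω hη, map_smul, map_mul, map_mul,
      star_mul_of_mem_tensorSubmodule (Γ.coact_mem k _ hω) (Γ.coact_mem l _ hη), h1, h2]
  · intro a
    refine ⟨Γ.ι_mem a, ?_⟩
    rw [← Γ.ι_star, Γ.coact_ι, Γ.coact_ι, HopfStarAlgebra.comul_star]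
    exact key _ Γ.ι_star _
  · intro a
    refine ⟨Γ.d_mem 0 _ (Γ.ι_mem a), ?_⟩
    rw [← Γ.d_star, ← Γ.ι_star, Γ.coact_d, Γ.coact_d, Γ.coact_ι, Γ.coact_ι,
      HopfStarAlgebra.comul_star, TensorProduct.map_map, TensorProduct.map_map]
    exact key (Γ.d ∘ₗ Γ.ι.toLinearMap) (fun a => by simp [Γ.ι_star, Γ.d_star]) _

theorem star_mem_inv {ω : Ω} (hω : ω ∈ Γ.inv) : star ω ∈ Γ.inv := by
  rw [mem_inv] at *
  rw [coact_star, hω]; simp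

end

namespace IsOriented

variable [StarModule ℂ A] [HopfStarAlgebra A]
variable (H : Γ.IsOriented h N ip θ) (hJ : Γ.IsIntegral h N θ J)
include H hJ

theorem integral_star_ι_mul {k : ℕ} {ω η : Ω}
    (hω : ω ∈ Γ.invForm k) (hη : η ∈ Γ.inv) (a b : A) :
    J (star (Γ.ι b * ω) * (Γ.ι a * η)) = h (star b * a) * J (star ω * η) := by
  rw [star_ι_mul b hω.1, mul_assoc, ← mul_assoc (Γ.ι (star b)), ← map_mul, ← mul_assoc,
    H.integral_mul_ι_mul hJ (star_mem_inv hω.2) hη]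

/-- `M` represents the pairing `∫ ω^* η` by the inner product of invariant forms; it is the inverse
of the Hodge operator there. Injectivity is non-degeneracy, since pairing with `aω` only adds a
factor `h`. -/
theorem exists_riesz_equiv :
    ∀ k ≤ N, ∃ M : Γ.invForm (N - k) →ₗ[ℂ] Γ.invForm k, Function.Bijective M ∧
      ∀ (η : Γ.invForm (N - k)) (ω : Γ.invForm k),
        J (star (ω : Ω) * η) = ipForm ip (M η) ω := by
  have := H.finite
  have hfd : ∀ k, FiniteDimensional ℂ (Γ.invForm k) := fun k =>
    Submodule.finiteDimensional_of_le (inf_le_right : Γ.form k ⊓ Γ.inv ≤ Γ.inv)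
  have key : ∀ k ≤ N, ∃ M : Γ.invForm (N - k) →ₗ[ℂ] Γ.invForm k, Function.Injective M ∧
      ∀ (η : Γ.invForm (N - k)) (ω : Γ.invForm k),
        J (star (ω : Ω) * η) = ipForm ip (M η) ω := by
    intro k hk
    obtain ⟨n, v, hv, hspan⟩ := exists_orthonormal_span_eq ip (Γ.invForm k)
    have hvm : ∀ i, v i ∈ Γ.invForm k := fun i => by
      rw [← hspan]; exact Submodule.subset_span ⟨i, rfl⟩
    let M : Γ.invForm (N - k) →ₗ[ℂ] Γ.invForm k :=
      ∑ i, LinearMap.toSpanSingleton ℂ (Γ.invForm k) ⟨v i, hvm i⟩ ∘ₗ J ∘ₗ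
        LinearMap.mulLeft ℂ (star (v i)) ∘ₗ (Γ.invForm (N - k)).subtype
    have hM : ∀ η, (M η : Ω) = ∑ i, J (star (v i) * η) • v i := by
      intro η
      simp [M]
    have hMip : ∀ (η : Γ.invForm (N - k)) (ω : Γ.invForm k),
        J (star (ω : Ω) * η) = ipForm ip (M η) ω := by
      intro η ω
      have hω : (ω : Ω) ∈ Submodule.span ℂ (Set.range v) := by
        rw [hspan]; exact ω.2
      have e := eq_sum_of_mem_span_orthonormal ip hv hω
      rw [hM, ipForm_sum_left]
      conv_lhs => rw [e]
      simp only [star_sum, star_smul, Finset.sum_mul, smul_mul_assoc, map_sum, map_smul,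
        smul_eq_mul, ipForm_smul_left]
      refine Finset.sum_congr rfl fun i _ => ?_
      rw [← ipForm_conj ip (ω : Ω) (v i), mul_comm]; rfl
    refine ⟨M, ?_, hMip⟩
    rw [← LinearMap.ker_eq_bot, LinearMap.ker_eq_bot']
    intro η hη
    have h0 : ∀ ω ∈ Γ.invForm k, J (star ω * η) = 0 := fun ω hω => by
      rw [hMip η ⟨ω, hω⟩, hη]; simp
    have : (η : Ω) = 0 := by
      refine H.eq_zero_of_integral_mul_eq_zero hJ η.2.1 fun ω' hω' => ?_
      rw [Nat.sub_sub_self hk] at hω'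
      rw [← star_star ω']
      refine Γ.inv_induction ip (p := fun ω => J (star ω * η) = 0) (fun a ω hω => ?_)
        (fun ω ω₂ h1 h2 => by rw [star_add, add_mul, map_add, h1, h2, add_zero])
        (Γ.star_mem _ _ hω')
      have := H.integral_star_ι_mul hJ hω η.2.2 1 a
      rw [map_one, one_mul] at this
      rw [this, h0 ω hω, mul_zero]
    exact Subtype.ext this
  have hle : ∀ k ≤ N, Module.finrank ℂ (Γ.invForm (N - k)) ≤ Module.finrank ℂ (Γ.invForm k) := by
    intro k hk
    obtain ⟨M, hM, -⟩ := key k hk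
    exact LinearMap.finrank_le_finrank_of_injective hM
  intro k hk
  obtain ⟨M, hM, hMip⟩ := key k hk
  refine ⟨M, ⟨hM, ?_⟩, hMip⟩
  -- Injectivity in the complementary degrees `k` and `N - k` bounds each dimension by the other.
  refine (LinearMap.injective_iff_surjective_of_finrank_eq_finrank
    (le_antisymm (hle k hk) ?_)).1 hM
  have := hle (N - k) (Nat.sub_le _ _)
  rwa [Nat.sub_sub_self hk] at this

theorem existsUnique_hodge :
    ∃! L : Ω →ₗ[ℂ] Ω, Γ.IsHodgeOperator N ip J L := by
  choose! M hM hMip using H.exists_riesz_equiv hJ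
  have hinv : ∀ k ≤ N, ∀ η : Γ.invForm (N - k), ∀ (a : A) (ω : Ω),
      J (star ω * (Γ.ι a * η)) = ipForm ip (Γ.ι a * M k η) ω := by
    intro k hk η a ω
    refine Γ.homogeneous_induction ω (fun l ω hω => ?_) fun ω₁ ω₂ h1 h2 => by
      rw [star_add, add_mul, map_add, h1, h2, ipForm_add_right]
    by_cases hl : l = k
    · subst hl
      refine Γ.inv_induction ip
        (p := fun ω => J (star ω * (Γ.ι a * η)) = ipForm ip (Γ.ι a * M l η) ω)
        (fun b ω hω => ?_) (fun ω₁ ω₂ h1 h2 => by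
          rw [star_add, add_mul, map_add, h1, h2, ipForm_add_right]) hω
      rw [H.integral_star_ι_mul hJ hω η.2.2, hMip l hk η ⟨ω, hω⟩,
        H.leftInvariant _ _ _ (M l η).2.2 _ hω.2]
    · rw [H.graded k l (Ne.symm hl) _ (Γ.ι_mul_mem a (M k η).2.1) _ hω]
      exact H.integral_eq_zero hJ (by omega)
        (Γ.mul_mem _ _ _ _ (Γ.star_mem _ _ hω) (Γ.ι_mul_mem a η.2.1))
  have hex : ∀ ω, ∃ τ, ∀ η, J (star η * τ) = ipForm ip ω η := by
    intro ω
    refine Γ.homogeneous_induction ω (fun k ω hω => ?_) ?_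
    · rcases lt_or_ge N k with hk | hk
      · rw [H.form_eq_zero hk hω]; exact ⟨0, by simp⟩
      refine Γ.inv_induction ip (p := fun ω => ∃ τ, ∀ η, J (star η * τ) = ipForm ip ω η) ?_ ?_ hω
      · intro a ω hω
        obtain ⟨η, hη⟩ := (hM k hk).2 ⟨ω, hω⟩
        exact ⟨Γ.ι a * η, fun ζ => by rw [hinv k hk, hη]⟩
      · rintro ω₁ ω₂ ⟨τ, h1⟩ ⟨ρ, h2⟩
        exact ⟨τ + ρ, fun η => by rw [mul_add, map_add, h1, h2, ipForm_add_left]⟩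
    · rintro ω₁ ω₂ ⟨τ, h1⟩ ⟨ρ, h2⟩
      exact ⟨τ + ρ, fun η => by rw [mul_add, map_add, h1, h2, ipForm_add_left]⟩
  have huniq : ∀ {τ ρ : Ω}, (∀ η, J (star η * τ) = J (star η * ρ)) → τ = ρ := fun hτ =>
    H.eq_of_integral_mul_eq hJ fun ω' => by simpa using hτ (star ω')
  choose f hf using hex
  let L : Ω →ₗ[ℂ] Ω :=
    { toFun := f
      map_add' := fun x y => huniq fun η => by
        rw [hf, mul_add, map_add, hf, hf, ipForm_add_left]
      map_smul' := fun c x => huniq fun η => by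
        rw [hf, RingHom.id_apply, mul_smul_comm, map_smul, hf, ipForm_smul_left, smul_eq_mul] }
  have hL : ∀ ω η, J (star η * L ω) = ipForm ip ω η := hf
  have hLM : ∀ k ≤ N, ∀ η : Γ.invForm (N - k), ∀ a, L (Γ.ι a * M k η) = Γ.ι a * η :=
    fun k hk η a => huniq fun ω => by rw [hL, hinv k hk]
  refine ⟨L, ⟨?_, ?_, fun ω ω' => hL ω' ω⟩, ?_⟩
  · intro a ω
    refine Γ.homogeneous_induction ω (fun k ω hω => ?_) fun ω₁ ω₂ h1 h2 => by
      simp only [mul_add, map_add, h1, h2]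
    rcases lt_or_ge N k with hk | hk
    · rw [H.form_eq_zero hk hω]; simp
    refine Γ.inv_induction ip (p := fun ω => L (Γ.ι a * ω) = Γ.ι a * L ω) ?_
      (fun ω₁ ω₂ h1 h2 => by simp only [mul_add, map_add, h1, h2]) hω
    intro b ω hω
    obtain ⟨η, hη⟩ := (hM k hk).2 ⟨ω, hω⟩
    have hη' : (M k η : Ω) = ω := congr_arg Subtype.val hη
    rw [← hη', hLM k hk, ← mul_assoc, ← map_mul, hLM k hk, map_mul, mul_assoc]
  · intro k hk
    apply le_antisymm
    · rintro _ ⟨ω, hω, rfl⟩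
      refine Γ.inv_induction ip (p := fun ω => L ω ∈ Γ.form (N - k)) (fun a ω hω => ?_)
        (fun ω₁ ω₂ h1 h2 => by rw [map_add]; exact add_mem h1 h2) hω
      obtain ⟨η, hη⟩ := (hM k hk).2 ⟨ω, hω⟩
      have hη' : (M k η : Ω) = ω := congr_arg Subtype.val hη
      rw [← hη', hLM k hk]
      exact Γ.ι_mul_mem a η.2.1
    · intro ω hω
      refine Γ.inv_induction ip (p := fun ω => ω ∈ (Γ.form k).map L) (fun a η hη => ?_)
        (fun ω₁ ω₂ h1 h2 => add_mem h1 h2) hω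
      exact ⟨_, Γ.ι_mul_mem a (M k ⟨η, hη⟩).2.1, hLM k hk ⟨η, hη⟩ a⟩
  · intro L' hL'
    exact LinearMap.ext fun ω => huniq fun η => by rw [hL'.integral, hL]

/-- On `(k+1)`-forms, `d^*` is `L⁻¹ d L` up to sign, as one sees by expanding `∫ d(ω^* L(η)) = 0`;
on functions it is zero. -/
theorem existsUnique_codifferential :
    ∃! ds : Ω →ₗ[ℂ] Ω, IsAdjointFor ip Γ.d ds := by
  obtain ⟨L, hL, -⟩ := H.existsUnique_hodge hJ
  refine existsUnique_isAdjointFor ip Γ.d fun η => ?_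
  refine Γ.homogeneous_induction η (fun k η hη => ?_) ?_
  · rcases lt_or_ge N k with hk | hk
    · rw [H.form_eq_zero hk hη]; exact ⟨0, by simp⟩
    rcases k with _ | k
    · refine ⟨0, fun ω => ?_⟩
      rw [ipForm_zero_right]
      refine Γ.homogeneous_induction ω (fun l ω hω => ?_) fun ω₁ ω₂ h1 h2 => by
        rw [map_add, ipForm_add_left, h1, h2, add_zero]
      exact H.graded (l + 1) 0 (by omega) _ (Γ.d_mem l ω hω) _ hη
    have hLη : L η ∈ Γ.form (N - (k + 1)) := by
      rw [← hL.map_form _ hk]; exact ⟨η, hη, rfl⟩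
    have hd := Γ.d_mem _ _ hLη
    rw [show N - (k + 1) + 1 = N - k by omega, ← hL.map_form k (by omega)] at hd
    obtain ⟨τ, hτ, hLτ⟩ := hd
    refine ⟨-(-1 : ℂ) ^ k • τ, fun ω => ?_⟩
    refine Γ.homogeneous_induction ω (fun l ω hω => ?_) fun ω₁ ω₂ h1 h2 => by
      rw [map_add, ipForm_add_left, h1, h2, ipForm_add_left]
    rw [ipForm_smul_right]
    by_cases hl : l = k
    · subst hl
      have e := H.integral_d hJ (star ω * L η)
      rw [Γ.d_mul l _ _ (Γ.star_mem _ _ hω), Γ.d_star, map_add, hL.integral, ← hLτ, map_smul,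
        hL.integral, smul_eq_mul] at e
      have e' := congr_arg (starRingEnd ℂ) e
      rw [map_add, ipForm_conj, map_mul, ipForm_conj] at e'
      simp only [map_pow, map_neg, map_one, map_zero] at e' ⊢
      linear_combination e'
    · rw [H.graded (l + 1) (k + 1) (by omega) _ (Γ.d_mem l ω hω) _ hη, H.graded l k hl _ hω _ hτ,
        mul_zero]
  · rintro η₁ η₂ ⟨τ, h1⟩ ⟨ρ, h2⟩
    exact ⟨τ + ρ, fun ω => by rw [ipForm_add_right, ipForm_add_right, h1, h2]⟩

end IsOriented

end StarDifferentialCalculus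

/-! ### Positive operators on a complex inner product space. -/

section PositiveOperator

variable {V : Type*} [AddCommGroup V] [Module ℂ V] {ip : InnerProductSpace.Core ℂ V}
  {T : V →ₗ[ℂ] V} (hT : ∀ x, 0 ≤ ipForm ip (T x) x)
include hT

theorem ipForm_symm_of_nonneg (x y : V) : ipForm ip (T x) y = ipForm ip x (T y) := by
  let : NormedAddCommGroup V := ip.toNormedAddCommGroup
  let : InnerProductSpace ℂ V := InnerProductSpace.ofCore ip.toCore
  have hsymm : T.IsSymmetric := by
    rw [LinearMap.isSymmetric_iff_inner_map_self_real]
    intro v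
    have h1 : ipForm ip v (T v) = conj (ipForm ip (T v) v) := (ipForm_conj ip _ _).symm
    have h2 : conj (ipForm ip (T v) v) = ipForm ip (T v) v :=
      Complex.conj_eq_iff_im.2 (Complex.nonneg_iff.1 (hT v)).2.symm
    exact (ipForm_conj ip v (T v)).trans (h2.symm.trans h1.symm)
  exact (hsymm y x).symm

theorem eq_zero_of_ipForm_eq_zero {x : V} (hx : ipForm ip (T x) x = 0) : T x = 0 := by
  apply ipForm_definite ip
  have hs := ipForm_symm_of_nonneg hT
  have h1 : ∀ t : ℝ, 0 ≤ 2 * t * (ipForm ip (T x) (T x)).re +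
      t ^ 2 * (ipForm ip (T (T x)) (T x)).re := by
    intro t
    have := (Complex.nonneg_iff.1 (hT (x + (t : ℂ) • T x))).1
    simp only [map_add, map_smul, ipForm_add_left, ipForm_add_right, ipForm_smul_left,
      ipForm_smul_right, hx, hs (T x) x, Complex.conj_ofReal] at this
    simp only [Complex.add_re, Complex.re_ofReal_mul, Complex.zero_re] at this
    linarith
  set a := (ipForm ip (T x) (T x)).re with ha
  set b := (ipForm ip (T (T x)) (T x)).re with hb
  have ha0 : 0 ≤ a := (Complex.nonneg_iff.1 (ipForm_self_nonneg ip (T x))).1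
  have hb0 : 0 ≤ b := (Complex.nonneg_iff.1 (hT (T x))).1
  -- Positivity on `x + tTx` gives `2ta + t²b ≥ 0`. This value of `t` forces `a = 0`; the `+ 1`
  -- keeps the denominator positive even when `b = 0`.
  have h2 := h1 (-(a / (b + 1)))
  have h3 : a = 0 := by
    have hb1 : 0 < b + 1 := by linarith
    have e : 2 * -(a / (b + 1)) * a + (-(a / (b + 1))) ^ 2 * b =
        -(a ^ 2 * (b + 2) / (b + 1) ^ 2) := by field_simp; ring
    rw [e] at h2
    by_contra hne
    have : 0 < a ^ 2 * (b + 2) / (b + 1) ^ 2 := by positivity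
    linarith
  exact Complex.ext h3 (Complex.nonneg_iff.1 (ipForm_self_nonneg ip (T x))).2.symm

/-- A finite-dimensional subspace invariant under a positive injective operator is spanned by
eigenvectors with positive eigenvalues. -/
theorem le_span_eigenvectors (hinj : Function.Injective T) (W : Submodule ℂ V)
    [FiniteDimensional ℂ W] (hW : ∀ x ∈ W, T x ∈ W) :
    W ≤ Submodule.span ℂ {v | ∃ r : ℝ, 0 < r ∧ T v = (r : ℂ) • v} := by
  have hs := ipForm_symm_of_nonneg hT
  let : NormedAddCommGroup V := ip.toNormedAddCommGroup
  let : InnerProductSpace ℂ V := InnerProductSpace.ofCore ip.toCore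
  have hsymm : (T.restrict hW).IsSymmetric := fun x y => (hs y x).symm
  let b := hsymm.eigenvectorBasis rfl
  have hb : ∀ i, T (b i) = (hsymm.eigenvalues rfl i : ℂ) • (b i : V) := fun i =>
    congr_arg Subtype.val (hsymm.apply_eigenvectorBasis rfl i)
  have hne : ∀ i, (b i : V) ≠ 0 := fun i hi => b.toBasis.ne_zero i (by
    rw [OrthonormalBasis.coe_toBasis]; exact Subtype.ext hi)
  have hpos : ∀ i, 0 < hsymm.eigenvalues rfl i := by
    intro i
    have h1 := hT (b i)
    rw [hb, ipForm_smul_left] at h1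
    have h2 := ipForm_self_nonneg ip (b i : V)
    have h3 : ipForm ip (b i : V) (b i) ≠ 0 := fun h => hne i (ipForm_definite ip h)
    have h4 : 0 < ipForm ip (b i : V) (b i) := lt_of_le_of_ne h2 h3.symm
    have h5 : 0 < (ipForm ip (b i : V) (b i)).re := (Complex.pos_iff.1 h4).1
    have h6 := (Complex.nonneg_iff.1 h1).1
    rw [Complex.re_ofReal_mul] at h6
    refine lt_of_le_of_ne (nonneg_of_mul_nonneg_left h6 h5) fun h7 => hne i (hinj ?_)
    rw [hb, ← h7]; simp
  intro x hx
  have : x = ∑ i, b.repr ⟨x, hx⟩ i • (b i : V) := by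
    have := congr_arg Subtype.val (b.sum_repr ⟨x, hx⟩)
    simpa using this.symm
  rw [this]
  exact Submodule.sum_mem _ fun i _ => Submodule.smul_mem _ _
    (Submodule.subset_span ⟨_, hpos i, hb i⟩)

end PositiveOperator

/-! ### The twist and the square of the antipode. -/

namespace StarDifferentialCalculus

variable {A Ω : Type*} [Ring A] [HopfAlgebra ℂ A] [StarRing A]
  [Ring Ω] [Algebra ℂ Ω] [StarAddMonoid Ω] {Γ : StarDifferentialCalculus A Ω}
  {h : A →ₗ[ℂ] ℂ} {N : ℕ} {ip : InnerProductSpace.Core ℂ Ω} {θ : Ω} {J : Ω →ₗ[ℂ] ℂ}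

namespace IsOriented

variable (H : Γ.IsOriented h N ip θ)

section

variable (hJ : Γ.IsIntegral h N θ J)
include H hJ

/-- Strong left invariance of the integral. -/
theorem slice_mulLeft_coact (ω η : Ω) : slice (J ∘ₗ LinearMap.mulLeft ℂ ω) (Γ.coact η) =
    HopfAlgebra.antipode ℂ (slice (J ∘ₗ LinearMap.mulRight ℂ η) (Γ.coact ω)) := by
  have hadd : ∀ (ω₁ ω₂ : Ω) x, slice (A := A) (J ∘ₗ LinearMap.mulLeft ℂ (ω₁ + ω₂)) x =
      slice (J ∘ₗ LinearMap.mulLeft ℂ ω₁) x + slice (J ∘ₗ LinearMap.mulLeft ℂ ω₂) x := by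
    intro ω₁ ω₂ x
    induction x using TensorProduct.induction_on with
    | zero => simp
    | tmul a b => simp [add_mul, add_smul]
    | add a b ha hb => simp only [map_add, ha, hb]; abel
  have hsmul : ∀ (c : ℂ) (ω : Ω) x, slice (A := A) (J ∘ₗ LinearMap.mulLeft ℂ (c • ω)) x =
      c • slice (J ∘ₗ LinearMap.mulLeft ℂ ω) x := by
    intro c ω x
    induction x using TensorProduct.induction_on with
    | zero => simp
    | tmul a b => simp [mul_smul]
    | add a b ha hb => simp only [map_add, ha, hb, smul_add]
  refine Γ.homogeneous_induction ω (fun k ω hω => ?_) fun ω₁ ω₂ h1 h2 => by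
    rw [hadd, map_add, map_add, map_add, h1, h2]
  obtain ⟨n, v, u, hv, -, hmem⟩ := Γ.exists_orthonormalSubcomodule ip k hω
  clear hω
  induction hmem using Submodule.span_induction with
  | zero =>
    have := hsmul 0 0 (Γ.coact η)
    rw [zero_smul, zero_smul] at this
    rw [this]; simp
  | add x y _ _ hx hy => rw [hadd, map_add, map_add, map_add, hx, hy]
  | smul c x _ hx => rw [hsmul, map_smul, map_smul, map_smul, hx]
  | mem x hx =>
    obtain ⟨j, rfl⟩ := hx
    -- Left invariance of the integral on `v k * η`, seen as a linear system with matrix `u`;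
    -- multiplication by `S(u)` then inverts it.
    have key : ∀ k, ∑ l, u k l * slice (J ∘ₗ LinearMap.mulLeft ℂ (v l)) (Γ.coact η) =
        J (v k * η) • (1 : A) := by
      intro k
      rw [← H.slice_coact hJ, map_mul, hv.coact_eq]
      induction Γ.coact η using TensorProduct.induction_on with
      | zero => simp
      | tmul a b => simp [Finset.sum_mul]
      | add a b ha hb => simp only [map_add, mul_add, Finset.sum_add_distrib, ha, hb]
    calc slice (J ∘ₗ LinearMap.mulLeft ℂ (v j)) (Γ.coact η)
        = ∑ l, (∑ k, HopfAlgebra.antipode ℂ (u j k) * u k l) *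
            slice (J ∘ₗ LinearMap.mulLeft ℂ (v l)) (Γ.coact η) := by
          simp [hv.isCorepMatrix.sum_antipode_mul]
      _ = ∑ k, HopfAlgebra.antipode ℂ (u j k) *
            ∑ l, u k l * slice (J ∘ₗ LinearMap.mulLeft ℂ (v l)) (Γ.coact η) := by
          simp only [Finset.mul_sum, Finset.sum_mul, mul_assoc]
          exact Finset.sum_comm
      _ = _ := by simp [key, hv.coact_eq]

/-- The integral separates the points of `A ⊗ Ω`. -/
theorem eq_of_slice_mulRight_eq {x y : A ⊗[ℂ] Ω}
    (hxy : ∀ ω, slice (J ∘ₗ LinearMap.mulRight ℂ ω) x = slice (J ∘ₗ LinearMap.mulRight ℂ ω) y) :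
    x = y := by
  rw [← sub_eq_zero]
  have hz : ∀ ω, slice (J ∘ₗ LinearMap.mulRight ℂ ω) (x - y) = 0 := fun ω => by
    rw [map_sub, hxy, sub_self]
  generalize x - y = z at hz
  let b := Module.Basis.ofVectorSpace ℂ A
  obtain ⟨c, rfl⟩ := TensorProduct.eq_repr_basis_left b z
  have hc : ∀ i, c i = 0 := by
    intro i
    refine H.eq_of_integral_mul_eq' hJ fun ω' => ?_
    have h1 := congr_arg (b.coord i) (hz ω')
    rw [Finsupp.sum, map_sum, map_sum] at h1
    simp only [slice_tmul, map_smul, Module.Basis.coord_apply, Module.Basis.repr_self] at h1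
    rw [Finset.sum_eq_single i (fun j _ hj => by simp [hj])
      (fun hi => by simp [Finsupp.notMem_support_iff.1 hi])] at h1
    simpa using h1
  have : c = 0 := Finsupp.ext hc
  simp [this]

variable {σ : Ω ≃ₐ[ℂ] Ω} (hσ : Γ.IsTwistAutomorphism J σ)
include hσ

/-- The twist automorphism intertwines the coaction up to the square of the antipode. -/
theorem antipode_antipode_slice_twist (φ : Ω →ₗ[ℂ] ℂ) (ω : Ω) :
    HopfAlgebra.antipode ℂ (HopfAlgebra.antipode ℂ (slice φ (Γ.coact (σ ω)))) =
      slice (φ ∘ₗ σ.toLinearMap) (Γ.coact ω) := by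
  set S := HopfAlgebra.antipode ℂ (A := A)
  have hcongr : ∀ (k : ℕ) (φ ψ : Ω →ₗ[ℂ] ℂ), (∀ ω ∈ Γ.form k, φ ω = ψ ω) →
      ∀ x ∈ tensorSubmodule A (Γ.form k), slice φ x = slice ψ x := by
    intro k φ ψ hφψ x hx
    induction hx using Submodule.span_induction with
    | mem x hx =>
      obtain ⟨a, w, hw, rfl⟩ := hx
      simp [hφψ w hw]
    | zero => simp
    | add x y _ _ hx hy => rw [map_add, map_add, hx, hy]
    | smul c x _ hx => rw [map_smul, map_smul, hx]
  have hsm : ∀ (c : ℂ) (φ : Ω →ₗ[ℂ] ℂ) (x : A ⊗[ℂ] Ω), slice (c • φ) x = c • slice φ x := by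
    intro c φ x
    induction x using TensorProduct.induction_on with
    | zero => simp
    | tmul a b => simp [mul_smul]
    | add a b ha hb => simp only [map_add, ha, hb, smul_add]
  have haddJ : ∀ (η₁ η₂ : Ω) (T : Ω →ₗ[ℂ] Ω) x,
      slice (A := A) (J ∘ₗ LinearMap.mulRight ℂ (η₁ + η₂) ∘ₗ T) x =
      slice (J ∘ₗ LinearMap.mulRight ℂ η₁ ∘ₗ T) x +
        slice (J ∘ₗ LinearMap.mulRight ℂ η₂ ∘ₗ T) x := by
    intro η₁ η₂ T x
    induction x using TensorProduct.induction_on with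
    | zero => simp
    | tmul a b => simp [mul_add, add_smul]
    | add a b ha hb => simp only [map_add, ha, hb]; abel
  -- Strong left invariance absorbs one `S` and moves the coaction to `η`. The twist replaces `∫
  -- σ(ω)·` by `∫ ·ω`, and a second use absorbs the other `S` and moves the coaction back to `ω`.
  -- The two signs agree.
  have key : ∀ ω η, S (S (slice (J ∘ₗ LinearMap.mulRight ℂ η) (Γ.coact (σ ω)))) =
      slice (J ∘ₗ LinearMap.mulRight ℂ η ∘ₗ σ.toLinearMap) (Γ.coact ω) := by
    intro ω η
    refine Γ.homogeneous_induction ω (fun k ω hω => ?_) fun ω₁ ω₂ h1 h2 => by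
      simp only [map_add, h1, h2]
    refine Γ.homogeneous_induction η (fun l η hη => ?_) fun η₁ η₂ h1 h2 => by
      have := haddJ η₁ η₂ LinearMap.id (Γ.coact (σ ω))
      simp only [LinearMap.comp_id] at this
      rw [this, haddJ, map_add, map_add, h1, h2]
    rw [← H.slice_mulLeft_coact hJ]
    have e1 := hcongr l (J ∘ₗ LinearMap.mulLeft ℂ (σ ω))
      ((-1 : ℂ) ^ (k * l) • (J ∘ₗ LinearMap.mulRight ℂ ω)) (fun ω' hω' => by
        have := hσ.twist k l ω hω ω' hω'
        simp [this, ← mul_assoc, neg_one_pow_mul_self]) _ (Γ.coact_mem l η hη)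
    have e2 := hcongr k (J ∘ₗ LinearMap.mulRight ℂ η ∘ₗ σ.toLinearMap)
      ((-1 : ℂ) ^ (k * l) • (J ∘ₗ LinearMap.mulLeft ℂ η)) (fun ω' hω' => by
        have := hσ.twist k l ω' hω' η hη
        simp [this, ← mul_assoc, neg_one_pow_mul_self]) _ (Γ.coact_mem k ω hω)
    rw [e1, e2, hsm, hsm, map_smul, ← H.slice_mulLeft_coact hJ]
  have hslS : ∀ (φ : Ω →ₗ[ℂ] ℂ) (x : A ⊗[ℂ] Ω),
      slice φ (TensorProduct.map (S ∘ₗ S) LinearMap.id x) = S (S (slice φ x)) := by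
    intro φ x
    induction x using TensorProduct.induction_on with
    | zero => simp
    | tmul a b => simp
    | add a b ha hb => simp only [map_add, ha, hb]
  have heq : TensorProduct.map (S ∘ₗ S) LinearMap.id (Γ.coact (σ ω)) =
      TensorProduct.map LinearMap.id σ.toLinearMap (Γ.coact ω) :=
    H.eq_of_slice_mulRight_eq hJ fun η => by rw [hslS, slice_comp, key]; rfl
  rw [← hslS, heq, slice_comp]

end

variable [StarModule ℂ A] [HopfStarAlgebra A]
include H

/-- Left invariance of the inner product with respect to the coaction. -/
theorem sum_star_mul_slice {n : ℕ} {v : Fin n → Ω} {u : Matrix (Fin n) (Fin n) A}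
    (hv : Γ.IsOrthonormalSubcomodule ip v u) (j : Fin n) (ω : Ω) :
    ∑ l, star (u j l) * slice (ipLeft ip (v l)) (Γ.coact ω) = ipForm ip ω (v j) • (1 : A) := by
  refine Γ.homogeneous_induction ω (fun k ω hω => ?_) fun ω₁ ω₂ h1 h2 => by
    simp only [map_add, mul_add, Finset.sum_add_distrib, h1, h2, ipForm_add_left, add_smul]
  refine Γ.inv_induction ip (p := fun ω => ∑ l, star (u j l) * slice (ipLeft ip (v l)) (Γ.coact ω) =
    ipForm ip ω (v j) • (1 : A)) (fun a η hη => ?_) (fun ω₁ ω₂ h1 h2 => by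
    simp only [map_add, mul_add, Finset.sum_add_distrib, h1, h2, ipForm_add_left, add_smul]) hω
  let w := fun k => ∑ l, Γ.ι (HopfAlgebra.antipode ℂ (u k l)) * v l
  have hw : ∀ k, w k ∈ Γ.inv := hv.sum_antipode_mem_inv
  have hvw : ∀ j, v j = ∑ k, Γ.ι (u j k) * w k := hv.eq_sum_mul_inv
  have hip : ∀ a j, ipForm ip (Γ.ι a * η) (v j) =
      ∑ k, h (star (u j k) * a) * ipForm ip η (w k) := by
    intro a j
    rw [hvw j, ipForm_sum_right]
    exact Finset.sum_congr rfl fun k _ => H.leftInvariant _ _ _ hη.2 _ (hw k)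
  -- Each scalar `h(x)` is traded for `(id ⊗ h) Δ(x)`, after which both sides are expressed through
  -- `Δ(a)` and agree on elementary tensors.
  have hr : ipForm ip (Γ.ι a * η) (v j) • (1 : A) = ∑ k, ipForm ip η (w k) •
      (TensorProduct.rid ℂ A (TensorProduct.map LinearMap.id h
        (Coalgebra.comul (star (u j k) * a)))) := by
    simp only [hip, Finset.sum_smul, H.haar.right_inv, smul_smul, mul_comm]
  rw [hr, map_mul, Γ.coact_ι, Γ.mem_inv.1 hη.2]
  simp only [Bialgebra.comul_mul, HopfStarAlgebra.comul_star,
    hv.isCorepMatrix.comul, star_sum]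
  induction Coalgebra.comul (R := ℂ) a using TensorProduct.induction_on with
  | zero => simp
  | tmul a b =>
    simp only [TensorProduct.map_tmul, LinearMap.id_apply, AlgHom.toLinearMap_apply,
      Algebra.TensorProduct.tmul_mul_tmul, mul_one, slice_tmul, ipLeft_apply, hip,
      Finset.sum_mul, map_sum, TensorProduct.star_tmul, TensorProduct.rid_tmul, Finset.smul_sum,
      Finset.sum_smul]
    rw [Finset.sum_comm]
    simp only [smul_smul, mul_comm, Finset.mul_sum, mul_smul_comm]
  | add a b ha hb =>
    simp only [map_add, add_mul, mul_add, smul_add, Finset.sum_add_distrib, ha, hb]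

end IsOriented

end StarDifferentialCalculus

/-! ### Diagonalizability of a positive twist. -/

namespace StarDifferentialCalculus

variable {A Ω : Type*} [Ring A] [HopfAlgebra ℂ A] [StarRing A]
  [Ring Ω] [Algebra ℂ Ω] [StarAddMonoid Ω] {Γ : StarDifferentialCalculus A Ω}
  {h : A →ₗ[ℂ] ℂ} {N : ℕ} {ip : InnerProductSpace.Core ℂ Ω} {θ : Ω} {J : Ω →ₗ[ℂ] ℂ}

variable (Γ) in
/-- The forms `ω` with `Δ_Ω(ω) ∈ C ⊗ Ω`. -/
noncomputable def coefficientForms (C : Submodule ℂ A) : Submodule ℂ Ω :=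
  ⨅ φ : Ω →ₗ[ℂ] ℂ, C.comap (slice φ ∘ₗ Γ.coact.toLinearMap)

theorem mem_coefficientForms {C : Submodule ℂ A} {ω : Ω} :
    ω ∈ Γ.coefficientForms C ↔ ∀ φ, slice φ (Γ.coact ω) ∈ C := by
  simp [coefficientForms]

variable (Γ) in
theorem finiteDimensional_coefficientForms (ip : InnerProductSpace.Core ℂ Ω) [FiniteDimensional ℂ Γ.inv] (C : Submodule ℂ A)
    [FiniteDimensional ℂ C] : FiniteDimensional ℂ (Γ.coefficientForms C) := by
  have hle : Γ.coefficientForms C ≤ C.map Γ.ι.toLinearMap * Γ.inv := by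
    intro ω hω
    obtain ⟨m, hm⟩ := Γ.exists_eq_sum_proj ω
    rw [hm m le_rfl]
    refine Submodule.sum_mem _ fun k _ => ?_
    obtain ⟨n, φ, w, hw, e⟩ := Γ.exists_eq_sum_slice_mul_inv ip k (Γ.proj_mem k ω)
    rw [e]
    refine Submodule.sum_mem _ fun j _ => Submodule.mul_mem_mul ⟨_, ?_, rfl⟩ (hw j).2
    rw [Γ.coact_proj, slice_comp]
    exact mem_coefficientForms.1 hω _
  have h1 : (C.map Γ.ι.toLinearMap).FG := (Module.Finite.iff_fg.1 ‹_›).map _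
  have h2 : Γ.inv.FG := Module.Finite.iff_fg.1 ‹_›
  have : FiniteDimensional ℂ ↥(C.map Γ.ι.toLinearMap * Γ.inv) := Module.Finite.iff_fg.2 (h1.mul h2)
  exact Submodule.finiteDimensional_of_le hle

namespace IsOriented

variable [StarModule ℂ A] [HopfStarAlgebra A]
variable (H : Γ.IsOriented h N ip θ) (hJ : Γ.IsIntegral h N θ J)
  {σ : Ω ≃ₐ[ℂ] Ω} (hσ : Γ.IsTwistAutomorphism J σ) (hpos : ∀ ω : Ω, 0 ≤ ipForm ip (σ ω) ω)
include H hJ hσ hpos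

/-- The square of the antipode preserves the coefficient space of a finite-dimensional
subcomodule of `Ω`, in the sense that it has preimages there. -/
theorem exists_antipode_antipode_eq {n : ℕ} {v : Fin n → Ω} {u : Matrix (Fin n) (Fin n) A}
    (hv : Γ.IsOrthonormalSubcomodule ip v u) (i m : Fin n) :
    ∃ c ∈ Submodule.span ℂ (Set.range fun p : Fin n × Fin n => u p.1 p.2),
      HopfAlgebra.antipode ℂ (HopfAlgebra.antipode ℂ c) = u i m := by
  set S := HopfAlgebra.antipode ℂ (A := A)
  let G : Matrix (Fin n) (Fin n) ℂ := Matrix.of fun i j => ipForm ip (σ (v i)) (v j)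
  -- This is where positivity enters: a kernel vector of `G` yields `x` in the span of `v` with
  -- `⟨σ(x), x⟩ = 0`, hence `σ(x) = 0` and `x = 0`.
  have hdet : IsUnit G.det := by
    rw [isUnit_iff_ne_zero]
    intro h0
    obtain ⟨c, hc, hcG⟩ := Matrix.exists_vecMul_eq_zero_iff.2 h0
    have hx : ∀ j, ipForm ip (σ (∑ i, c i • v i)) (v j) = 0 := by
      intro j
      have := congr_fun hcG j
      simpa [Matrix.vecMul, dotProduct, G, map_sum, ipForm_sum_left, ipForm_smul_left] using this
    have hx0 : ipForm ip (σ (∑ i, c i • v i)) (∑ i, c i • v i) = 0 := by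
      rw [ipForm_sum_right]
      simp only [ipForm_smul_right, hx, mul_zero, Finset.sum_const_zero]
    have h1 : σ (∑ i, c i • v i) = 0 := eq_zero_of_ipForm_eq_zero (T := σ.toLinearMap) hpos hx0
    rw [map_eq_zero_iff σ σ.injective] at h1
    apply hc
    funext j
    have := congr_arg (ipLeft ip (v j)) h1
    simpa [ipForm_sum_left, ipForm_smul_left, hv.orthonormal] using this
  have hmul : G * G⁻¹ = 1 := Matrix.mul_nonsing_inv G hdet
  let X := u.map star
  have hX1 : X * u.transpose = 1 := by
    ext j i
    have := H.sum_star_mul_slice hv j (v i)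
    simp only [hv.slice_coact, hv.orthonormal] at this
    simp only [X, Matrix.mul_apply, Matrix.map_apply, Matrix.transpose_apply, this, Matrix.one_apply,
      eq_comm (a := i)]
    split_ifs <;> simp
  -- `X` also has the left inverse `S(X)`, which must therefore coincide with its right inverse
  -- `u.transpose`.
  have hX2 : u.transpose * X = 1 := by
    rw [← left_inv_eq_right_inv hv.isCorepMatrix.star.antipode_mul hX1]
    exact hv.isCorepMatrix.star.antipode_mul
  -- The span of `v` need not be `σ`-stable, so `M` records only components along `v`. Unitarity
  -- gives `M = G u`, the intertwining relation gives `S²(M) = u G`, and so the entries of `M G⁻¹`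
  -- are the required preimages.
  let M : Matrix (Fin n) (Fin n) A := Matrix.of fun i l => slice (ipLeft ip (v l)) (Γ.coact (σ (v i)))
  have hM : X * M.transpose = (G.map fun c => c • (1 : A)).transpose := by
    ext j i
    simpa [Matrix.mul_apply, X, M, G] using H.sum_star_mul_slice hv j (σ (v i))
  have hM' : M.transpose = u.transpose * (G.map fun c => c • (1 : A)).transpose := by
    rw [← hM, ← Matrix.mul_assoc, hX2, Matrix.one_mul]
  have hMmem : ∀ i l, M i l ∈
      Submodule.span ℂ (Set.range fun p : Fin n × Fin n => u p.1 p.2) := by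
    intro i l
    have := congr_fun (congr_fun hM' l) i
    simp only [Matrix.transpose_apply, Matrix.mul_apply, Matrix.map_apply, mul_smul_comm,
      mul_one] at this
    rw [this]
    exact Submodule.sum_mem _ fun k _ =>
      Submodule.smul_mem _ _ (Submodule.subset_span ⟨(k, l), rfl⟩)
  have hSM : ∀ i l, S (S (M i l)) = ∑ k, G k l • u i k := by
    intro i l
    have := H.antipode_antipode_slice_twist hJ hσ (ipLeft ip (v l)) (v i)
    rw [hv.coact_eq, map_sum] at this
    simpa [M, G] using this
  refine ⟨∑ l, G⁻¹ l m • M i l,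
    Submodule.sum_mem _ fun l _ => Submodule.smul_mem _ _ (hMmem i l), ?_⟩
  have h1 : ∀ k, ∑ l, G k l * G⁻¹ l m = if k = m then 1 else 0 := fun k => by
    simpa [Matrix.mul_apply, Matrix.one_apply] using congr_fun (congr_fun hmul k) m
  simp only [map_sum, map_smul, hSM, Finset.smul_sum, smul_smul]
  rw [Finset.sum_comm]
  simp only [← Finset.sum_smul, mul_comm (G⁻¹ _ _), h1]
  simp

theorem mem_span_eigenvectors (ω : Ω) :
    ω ∈ Submodule.span ℂ {v | ∃ r : ℝ, 0 < r ∧ σ v = (r : ℂ) • v} := by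
  refine Γ.homogeneous_induction ω (fun k ω hω => ?_) fun ω₁ ω₂ h1 h2 => add_mem h1 h2
  obtain ⟨n, v, u, hv, -, hmem⟩ := Γ.exists_orthonormalSubcomodule ip k hω
  set C := Submodule.span ℂ (Set.range fun p : Fin n × Fin n => u p.1 p.2) with hC
  have : FiniteDimensional ℂ C := FiniteDimensional.span_of_finite ℂ (Set.finite_range _)
  have := H.finite
  have := Γ.finiteDimensional_coefficientForms ip C
  have hCS : ∀ c ∈ C, ∃ c' ∈ C, HopfAlgebra.antipode ℂ (HopfAlgebra.antipode ℂ c') = c := by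
    intro c hc
    induction hc using Submodule.span_induction with
    | mem x hx =>
      obtain ⟨⟨i, j⟩, rfl⟩ := hx
      exact H.exists_antipode_antipode_eq hJ hσ hpos hv i j
    | zero => exact ⟨0, zero_mem _, by simp⟩
    | add x y _ _ hx hy =>
      obtain ⟨a, ha, rfl⟩ := hx
      obtain ⟨b, hb, rfl⟩ := hy
      exact ⟨a + b, add_mem ha hb, by simp⟩
    | smul t x _ hx =>
      obtain ⟨a, ha, rfl⟩ := hx
      exact ⟨t • a, Submodule.smul_mem _ _ ha, by simp⟩
  -- `S²` of a slice of `Δ_Ω(σ(ω))` is a slice of `Δ_Ω(ω)`, hence lies in `C ⊆ S²(C)`; injectivity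
  -- of `S` puts the original slice in `C`.
  have hinv : ∀ ω ∈ Γ.coefficientForms C, σ ω ∈ Γ.coefficientForms C := by
    intro ω hω
    rw [mem_coefficientForms] at hω ⊢
    intro φ
    obtain ⟨c, hc, hc'⟩ := hCS _ (hω (φ ∘ₗ σ.toLinearMap))
    rw [← H.antipode_antipode_slice_twist hJ hσ] at hc'
    rwa [← Γ.antipode_injective ip (Γ.antipode_injective ip hc')]
  have hωC : ω ∈ Γ.coefficientForms C := by
    rw [mem_coefficientForms]
    intro φ
    clear hω
    induction hmem using Submodule.span_induction with
    | mem x hx =>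
      obtain ⟨j, rfl⟩ := hx
      rw [hv.coact_eq, map_sum]
      simp only [slice_tmul]
      exact Submodule.sum_mem _ fun k _ =>
        Submodule.smul_mem _ _ (Submodule.subset_span ⟨(j, k), rfl⟩)
    | zero => simp
    | add x y _ _ hx hy => simp only [map_add]; exact add_mem hx hy
    | smul c x _ hx => simp only [map_smul]; exact Submodule.smul_mem _ _ hx
  exact le_span_eigenvectors (T := σ.toLinearMap) hpos σ.injective (Γ.coefficientForms C) hinv hωC

end IsOriented

end StarDifferentialCalculus

/-! ### Imaginary powers and functions of exponential type. -/

/-- The function `z ↦ r ^ (-iz)`. -/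
noncomputable def imaginaryPower (r : ℝ) (z : ℂ) : ℂ :=
  Complex.exp (-(Complex.I * z * (Real.log r : ℂ)))

theorem imaginaryPower_zero (r : ℝ) : imaginaryPower r 0 = 1 := by simp [imaginaryPower]

theorem imaginaryPower_one (z : ℂ) : imaginaryPower 1 z = 1 := by simp [imaginaryPower]

theorem imaginaryPower_add (r : ℝ) (y z : ℂ) :
    imaginaryPower r (y + z) = imaginaryPower r y * imaginaryPower r z := by
  rw [imaginaryPower, imaginaryPower, imaginaryPower, ← Complex.exp_add]
  congr 1; ring

theorem imaginaryPower_mul {r s : ℝ} (hr : 0 < r) (hs : 0 < s) (z : ℂ) :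
    imaginaryPower (r * s) z = imaginaryPower r z * imaginaryPower s z := by
  rw [imaginaryPower, imaginaryPower, imaginaryPower, ← Complex.exp_add,
    Real.log_mul hr.ne' hs.ne']
  congr 1; push_cast; ring

theorem imaginaryPower_I {r : ℝ} (hr : 0 < r) : imaginaryPower r Complex.I = r := by
  rw [imaginaryPower, Complex.I_mul_I, neg_one_mul, neg_neg, ← Complex.ofReal_exp,
    Real.exp_log hr]

theorem conj_imaginaryPower (r : ℝ) (z : ℂ) :
    conj (imaginaryPower r z) = imaginaryPower r (-conj z) := by
  rw [imaginaryPower, imaginaryPower, ← Complex.exp_conj]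
  simp

theorem imaginaryPower_inv (r : ℝ) (z : ℂ) :
    imaginaryPower r⁻¹ z = imaginaryPower r (-z) := by
  simp [imaginaryPower]

theorem differentiable_imaginaryPower (r : ℝ) : Differentiable ℂ (imaginaryPower r) := by
  unfold imaginaryPower; fun_prop

theorem norm_imaginaryPower (r : ℝ) (z : ℂ) :
    ‖imaginaryPower r z‖ = Real.exp (z.im * Real.log r) := by
  rw [imaginaryPower, Complex.norm_exp]
  simp

theorem isExponentialType_imaginaryPower (r : ℝ) : IsExponentialType (imaginaryPower r) := by
  refine ⟨differentiable_imaginaryPower r, 1, |Real.log r| + 1, one_pos, by positivity,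
    fun z => ?_⟩
  rw [norm_imaginaryPower, one_mul, Real.exp_le_exp]
  calc z.im * Real.log r ≤ |z.im * Real.log r| := le_abs_self _
    _ = |Real.log r| * |z.im| := by rw [abs_mul, mul_comm]
    _ ≤ (|Real.log r| + 1) * |z.im| := by gcongr; linarith

theorem IsFiniteExponentialType.add {V : Type*} [AddCommGroup V] [Module ℂ V] {F G : ℂ → V}
    (hF : IsFiniteExponentialType F) (hG : IsFiniteExponentialType G) :
    IsFiniteExponentialType fun z => F z + G z := by
  obtain ⟨n, v, f, hf, hF⟩ := hF
  obtain ⟨m, w, g, hg, hG⟩ := hG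
  refine ⟨n + m, Fin.append v w, Fin.append f g, fun j => ?_, fun z => ?_⟩
  · refine Fin.addCases (fun i => ?_) (fun i => ?_) j
    · simpa using hf i
    · simpa using hg i
  · simp [Fin.sum_univ_add, hF, hG]

/-- A finite sum of functions of exponential type that is periodic with period `i` after
multiplication by `r ^ (iz)` is determined by its value at `0`. -/
theorem eq_imaginaryPower_of_quasiperiodic {r : ℝ} (hr : 0 < r) {n : ℕ} {f : Fin n → ℂ → ℂ}
    (hf : ∀ j, IsExponentialType (f j)) (c : Fin n → ℂ)
    (hper : ∀ z, ∑ j, f j (z + Complex.I) * c j = r * ∑ j, f j z * c j) (z : ℂ) :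
    ∑ j, f j z * c j = imaginaryPower r z * ∑ j, f j 0 * c j := by
  set g : ℂ → ℂ := fun z => imaginaryPower r (-z) * ∑ j, f j z * c j with hg
  have hd : Differentiable ℂ g := by
    refine ((differentiable_imaginaryPower r).comp differentiable_neg).mul ?_
    exact Differentiable.fun_sum fun j _ => (hf j).1.mul_const _
  have hgp : Function.Periodic g Complex.I := by
    intro z
    simp only [hg]
    have h1 : imaginaryPower r (-Complex.I) * r = 1 := by
      rw [← imaginaryPower_I hr, ← imaginaryPower_add, neg_add_cancel, imaginaryPower_zero]
    rw [hper, neg_add, imaginaryPower_add]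
    linear_combination (imaginaryPower r (-z) * ∑ j, f j z * c j) * h1
  choose hfd M R hM hR hfb using hf
  -- On the strip `0 ≤ Im z ≤ 1` the exponential-type bounds are constants, and periodicity carries
  -- the bound to the whole plane. Liouville's theorem then applies.
  have hb : ∀ z, ‖g z‖ ≤ Real.exp |Real.log r| * ∑ j, M j * Real.exp (R j) * ‖c j‖ := by
    have hstrip : ∀ z : ℂ, 0 ≤ z.im → z.im ≤ 1 →
        ‖g z‖ ≤ Real.exp |Real.log r| * ∑ j, M j * Real.exp (R j) * ‖c j‖ := by
      intro z h0 h1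
      have hz : |z.im| ≤ 1 := abs_le.2 ⟨by linarith, h1⟩
      rw [hg, norm_mul]
      refine mul_le_mul ?_ ?_ (norm_nonneg _) (Real.exp_pos _).le
      · rw [norm_imaginaryPower, Real.exp_le_exp]
        calc (-z).im * Real.log r ≤ |(-z).im * Real.log r| := le_abs_self _
          _ = |z.im| * |Real.log r| := by rw [abs_mul, Complex.neg_im, abs_neg]
          _ ≤ 1 * |Real.log r| := by gcongr
          _ = _ := one_mul _
      · refine (norm_sum_le _ _).trans (Finset.sum_le_sum fun j _ => ?_)
        rw [norm_mul]
        refine mul_le_mul_of_nonneg_right ((hfb j z).trans ?_) (norm_nonneg _)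
        refine mul_le_mul_of_nonneg_left (Real.exp_le_exp.2 ?_) (hM j).le
        calc R j * |z.im| ≤ R j * 1 := by have := (hR j).le; gcongr
          _ = R j := mul_one _
    intro z
    rw [← hgp.sub_zsmul_eq ⌊z.im⌋]
    apply hstrip
    · simp
    · have := (Int.lt_floor_add_one z.im).le
      simp only [zsmul_eq_mul, Complex.sub_im, Complex.mul_im, Complex.intCast_re, Complex.I_im,
        Complex.intCast_im, Complex.I_re, mul_one, mul_zero, add_zero]
      linarith
  have hconst := hd.apply_eq_apply_of_bounded
    (isBounded_iff_forall_norm_le.2 ⟨_, Set.forall_mem_range.2 hb⟩) z 0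
  simp only [hg, neg_zero, imaginaryPower_zero, one_mul] at hconst
  rw [← hconst, ← mul_assoc, ← imaginaryPower_add, add_neg_cancel, imaginaryPower_zero, one_mul]

/-! ### One-parameter groups generated by a diagonalizable automorphism. -/

section EigenvectorSpan

variable {Ω : Type*} [Ring Ω] [Algebra ℂ Ω] {σ : Ω ≃ₐ[ℂ] Ω}
  (hspan : ∀ ω, ω ∈ Submodule.span ℂ {v | ∃ r : ℝ, 0 < r ∧ σ v = (r : ℂ) • v})
include hspan

@[elab_as_elim]
theorem eigenvector_induction {p : Ω → Prop}
    (eig : ∀ (r : ℝ), 0 < r → ∀ v, σ v = (r : ℂ) • v → p v)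
    (add : ∀ ω η, p ω → p η → p (ω + η)) (ω : Ω) : p ω := by
  refine Submodule.closure_induction (p := fun x _ => p x) ?_ ?_ ?_ (hspan ω)
  · exact eig 1 one_pos 0 (by simp)
  · intro x y _ _; exact add x y
  · rintro c x ⟨r, hr, hx⟩
    exact eig r hr (c • x) (by rw [map_smul, hx, smul_comm])

/-- The functional calculus of a diagonalizable operator. -/
theorem exists_linearMap_eigenvector (f : ℝ → ℂ) : ∃ F : Ω →ₗ[ℂ] Ω, ∀ r : ℝ, ∀ v,
    σ v = (r : ℂ) • v → F v = f r • v := by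
  classical
  let T : Module.End ℂ Ω := σ.toLinearMap
  have hint : DirectSum.IsInternal T.eigenspace := by
    refine DirectSum.isInternal_submodule_of_iSupIndep_of_iSup_eq_top T.eigenspaces_iSupIndep ?_
    rw [eq_top_iff]
    intro ω _
    refine Submodule.span_le.2 ?_ (hspan ω)
    rintro v ⟨r, -, hv⟩
    exact Submodule.mem_iSup_of_mem (r : ℂ) (Module.End.mem_eigenspace_iff.2 hv)
  -- The eigenspaces are indexed by all of `ℂ`; `μ.re` is a harmless extension, since only real `μ`
  -- are used.
  refine ⟨hint.linearGlue fun μ => f μ.re • (T.eigenspace μ).subtype, fun r v hv => ?_⟩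
  rw [hint.linearGlue_apply _ (k := (r : ℂ)) (Module.End.mem_eigenspace_iff.2 hv)]
  simp

theorem exists_algEquiv_imaginaryPower : ∃ β : ℂ → (Ω ≃ₐ[ℂ] Ω), ∀ z : ℂ, ∀ r : ℝ, 0 < r → ∀ v,
    σ v = (r : ℂ) • v → β z v = imaginaryPower r z • v := by
  choose F hF using fun z : ℂ => exists_linearMap_eigenvector hspan fun r => imaginaryPower r z
  have hone : ∀ z, F z 1 = 1 := fun z => by
    rw [hF z 1 1 (by simp), imaginaryPower_one, one_smul]
  have hmul : ∀ z ω η, F z (ω * η) = F z ω * F z η := by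
    intro z ω η
    refine eigenvector_induction hspan (fun r hr v hv => ?_)
      (fun ω₁ ω₂ h1 h2 => by simp only [add_mul, map_add, h1, h2]) ω
    refine eigenvector_induction hspan (fun s hs w hw => ?_)
      (fun ω₁ ω₂ h1 h2 => by simp only [mul_add, map_add, h1, h2]) η
    rw [hF z r v hv, hF z s w hw, hF z (r * s) (v * w) (by
      rw [map_mul, hv, hw, smul_mul_smul_comm]; push_cast; rfl), imaginaryPower_mul hr hs,
      smul_mul_smul_comm]
  have hinv : ∀ z ω, F z (F (-z) ω) = ω := by
    intro z ω
    refine eigenvector_induction hspan (fun r hr v hv => ?_)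
      (fun ω₁ ω₂ h1 h2 => by simp only [map_add, h1, h2]) ω
    rw [hF (-z) r v hv, map_smul, hF z r v hv, smul_smul, ← imaginaryPower_add, neg_add_cancel,
      imaginaryPower_zero, one_smul]
  let G : ℂ → (Ω →ₐ[ℂ] Ω) := fun z => AlgHom.ofLinearMap (F z) (hone z) (hmul z)
  refine ⟨fun z => AlgEquiv.ofAlgHom (G z) (G (-z)) (AlgHom.ext fun ω => hinv z ω)
    (AlgHom.ext fun ω => ?_), fun z r _ v hv => hF z r v hv⟩
  have := hinv (-z) ω
  rwa [neg_neg] at this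

theorem isExponentialOneParameterGroup_of_eigenvector [StarAddMonoid Ω] [StarModule ℂ Ω]
    (hstar : ∀ ω, σ (star (σ ω)) = star ω) {β : ℂ → (Ω ≃ₐ[ℂ] Ω)}
    (hβ : ∀ z : ℂ, ∀ r : ℝ, 0 < r → ∀ v, σ v = (r : ℂ) • v → β z v = imaginaryPower r z • v) :
    IsExponentialOneParameterGroup β ∧ β Complex.I = σ := by
  refine ⟨⟨fun y z ω => ?_, fun z ω => ?_, fun ω => ?_⟩, AlgEquiv.ext fun ω => ?_⟩
  · refine eigenvector_induction hspan (fun r hr v hv => ?_)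
      (fun ω₁ ω₂ h1 h2 => by simp only [map_add, h1, h2]) ω
    rw [hβ _ r hr v hv, hβ z r hr v hv, map_smul, hβ y r hr v hv, smul_smul, imaginaryPower_add,
      mul_comm]
  · refine eigenvector_induction hspan (fun r hr v hv => ?_)
      (fun ω₁ ω₂ h1 h2 => by simp only [map_add, star_add, h1, h2]) ω
    -- The involution inverts eigenvalues, which turns the exponent `-conj z` from conjugation into
    -- `conj z`.
    have hv' : σ (star v) = ((r⁻¹ : ℝ) : ℂ) • star v := by
      have := hstar v
      rw [hv, star_smul, map_smul] at this
      have hr' : star (r : ℂ) = r := Complex.conj_ofReal r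
      have hrc : (r : ℂ) ≠ 0 := Complex.ofReal_ne_zero.2 hr.ne'
      rw [hr'] at this
      rw [Complex.ofReal_inv, eq_inv_smul_iff₀ hrc, this]
    rw [hβ z r hr v hv, hβ _ _ (inv_pos.2 hr) _ hv', star_smul, imaginaryPower_inv,
      ← conj_imaginaryPower]
    rfl
  · refine eigenvector_induction hspan (fun r hr v hv => ?_) (fun ω₁ ω₂ h1 h2 => by
      simp only [map_add]; exact h1.add h2) ω
    exact ⟨1, fun _ => v, fun _ => imaginaryPower r, fun _ => isExponentialType_imaginaryPower r,
      fun z => by simp [hβ z r hr v hv]⟩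
  · refine eigenvector_induction hspan (fun r hr v hv => ?_)
      (fun ω₁ ω₂ h1 h2 => by simp only [map_add, h1, h2]) ω
    rw [hβ _ r hr v hv, hv, imaginaryPower_I hr]

-- Since `β_{z+i} = β_z σ`, each scalar function `φ(β_z v)` is multiplied by `r` under the shift by
-- `i`, and the Liouville argument identifies it.
omit hspan in
theorem IsExponentialOneParameterGroup.apply_eigenvector [StarAddMonoid Ω]
    {β : ℂ → (Ω ≃ₐ[ℂ] Ω)} (hβ : IsExponentialOneParameterGroup β) (hI : β Complex.I = σ)
    (z : ℂ) {r : ℝ} (hr : 0 < r) {v : Ω} (hv : σ v = (r : ℂ) • v) :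
    β z v = imaginaryPower r z • v := by
  have h0 : β 0 v = v := (β 0).injective (by rw [← hβ.add, add_zero])
  obtain ⟨n, w, f, hf, hF⟩ := hβ.exponential v
  rw [← sub_eq_zero, ← Module.forall_dual_apply_eq_zero_iff ℂ]
  intro φ
  have hφ : ∀ z, φ (β z v) = ∑ j, f j z * φ (w j) := fun z => by
    have := hF z
    beta_reduce at this
    rw [this]; simp
  have := eq_imaginaryPower_of_quasiperiodic hr hf (fun j => φ (w j)) (fun z => by
    rw [← hφ, ← hφ, hβ.add, hI, hv, map_smul, map_smul, smul_eq_mul]) z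
  rw [← hφ, ← hφ, h0] at this
  rw [map_sub, this, map_smul, smul_eq_mul, sub_self]

theorem existsUnique_exponentialOneParameterGroup [StarAddMonoid Ω] [StarModule ℂ Ω]
    (hstar : ∀ ω, σ (star (σ ω)) = star ω) :
    ∃! β : ℂ → (Ω ≃ₐ[ℂ] Ω), IsExponentialOneParameterGroup β ∧ β Complex.I = σ := by
  obtain ⟨β, hβ⟩ := exists_algEquiv_imaginaryPower hspan
  refine ⟨β, isExponentialOneParameterGroup_of_eigenvector hspan hstar hβ, ?_⟩
  rintro γ ⟨hγ, hI⟩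
  refine funext fun z => AlgEquiv.ext fun ω => ?_
  refine eigenvector_induction hspan (fun r hr v hv => ?_)
    (fun ω₁ ω₂ h1 h2 => by simp only [map_add, h1, h2]) ω
  rw [hβ z r hr v hv, hγ.apply_eigenvector hI z hr hv]

namespace IsExponentialOneParameterGroup

variable [StarAddMonoid Ω] {β : ℂ → (Ω ≃ₐ[ℂ] Ω)} (hβ : IsExponentialOneParameterGroup β)
  (hI : β Complex.I = σ)
include hβ hI

theorem commute_of_commute (T : Ω →ₗ[ℂ] Ω) (hT : ∀ ω, T (σ ω) = σ (T ω)) (z : ℂ) (ω : Ω) :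
    T (β z ω) = β z (T ω) := by
  refine eigenvector_induction hspan (fun r hr v hv => ?_)
    (fun ω₁ ω₂ h1 h2 => by simp only [map_add, h1, h2]) ω
  have hTv : σ (T v) = (r : ℂ) • T v := by rw [← hT, hv, map_smul]
  rw [hβ.apply_eigenvector hI z hr hv, hβ.apply_eigenvector hI z hr hTv, map_smul]

variable {ip : InnerProductSpace.Core ℂ Ω} (hpos : ∀ ω : Ω, 0 ≤ ipForm ip (σ ω) ω)
include hpos

theorem ipForm_apply (z : ℂ) (ω η : Ω) :
    ipForm ip (β z ω) η = ipForm ip ω (β (-conj z) η) := by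
  refine eigenvector_induction hspan (fun r hr v hv => ?_)
    (fun ω₁ ω₂ h1 h2 => by simp only [map_add, ipForm_add_left, h1, h2]) ω
  refine eigenvector_induction hspan (fun s hs w hw => ?_)
    (fun ω₁ ω₂ h1 h2 => by simp only [map_add, ipForm_add_right, h1, h2]) η
  rw [hβ.apply_eigenvector hI z hr hv, hβ.apply_eigenvector hI _ hs hw, ipForm_smul_left,
    ipForm_smul_right, ← conj_imaginaryPower, Complex.conj_conj]
  have hsymm : ipForm ip (σ v) w = ipForm ip v (σ w) :=
    ipForm_symm_of_nonneg (T := σ.toLinearMap) hpos v w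
  rw [hv, hw, ipForm_smul_left, ipForm_smul_right, Complex.conj_ofReal] at hsymm
  -- Eigenvectors of the symmetric `σ` for distinct eigenvalues are orthogonal; for equal ones the
  -- two scalars coincide.
  by_cases hrs : r = s
  · rw [hrs]
  · have : ipForm ip v w = 0 := by
      have h1 : ((r : ℂ) - s) * ipForm ip v w = 0 := by linear_combination hsymm
      refine (mul_eq_zero.1 h1).resolve_left fun h2 => hrs ?_
      exact_mod_cast sub_eq_zero.1 h2
    rw [this, mul_zero, mul_zero]

/-- The left-hand operator is the square of the symmetric operator `β_{it/2}`, so the value is the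
squared norm of `β_{it/2}(ω)`. -/
theorem ipForm_apply_self_nonneg (t : ℝ) (ω : Ω) : 0 ≤ ipForm ip (β (t * Complex.I) ω) ω := by
  have h1 : (t : ℂ) * Complex.I = (t / 2 : ℝ) * Complex.I + (t / 2 : ℝ) * Complex.I := by
    push_cast; ring
  have h2 : -conj (((t / 2 : ℝ) : ℂ) * Complex.I) = (t / 2 : ℝ) * Complex.I := by
    rw [map_mul, Complex.conj_ofReal, Complex.conj_I]; ring
  rw [h1, hβ.add, hβ.ipForm_apply hspan hI hpos, h2]
  exact ipForm_self_nonneg ip _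

theorem adjoint_commute {T S : Ω →ₗ[ℂ] Ω} (hS : IsAdjointFor ip T S)
    (hT : ∀ z ω, T (β z ω) = β z (T ω)) (z : ℂ) (η : Ω) : S (β z η) = β z (S η) := by
  refine ipForm_ext_right ip fun ω => ?_
  have hz : -conj (-conj z) = z := by simp
  have h1 := hβ.ipForm_apply hspan hI hpos (-conj z)
  rw [hz] at h1
  rw [← hS, ← h1, ← h1, ← hS, hT]

end IsExponentialOneParameterGroup

end EigenvectorSpan

namespace StarDifferentialCalculus

variable {A Ω : Type*} [Ring A] [HopfAlgebra ℂ A] [StarRing A]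
  [Ring Ω] [Algebra ℂ Ω] [StarAddMonoid Ω] {Γ : StarDifferentialCalculus A Ω}
  {h : A →ₗ[ℂ] ℂ} {N : ℕ} {ip : InnerProductSpace.Core ℂ Ω} {θ : Ω} {J : Ω →ₗ[ℂ] ℂ}

/-- Pairing with `η^*`: `∫ η^* L(σω) = ⟨ω, ση⟩ = ∫ σ(η)^* L(ω)`. Applying the integral-preserving
`σ` inside turns `σ(η)^*` back into `η^*`. -/
theorem IsOriented.hodge_twist (H : Γ.IsOriented h N ip θ) (hJ : Γ.IsIntegral h N θ J)
    {σ : Ω ≃ₐ[ℂ] Ω} (hσ : Γ.IsTwistAutomorphism J σ) (hpos : ∀ ω : Ω, 0 ≤ ipForm ip (σ ω) ω)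
    {L : Ω →ₗ[ℂ] Ω} (hL : Γ.IsHodgeOperator N ip J L) (ω : Ω) : L (σ ω) = σ (L ω) := by
  refine H.eq_of_integral_mul_eq hJ fun ω' => ?_
  obtain ⟨η, rfl⟩ : ∃ η, star η = ω' := ⟨star ω', star_star ω'⟩
  have hsymm : ipForm ip (σ ω) η = ipForm ip ω (σ η) :=
    ipForm_symm_of_nonneg (T := σ.toLinearMap) hpos ω η
  rw [hL.integral, hsymm, ← hL.integral, ← hσ.integral_eq, map_mul, H.twist_star_twist hJ hσ]

end StarDifferentialCalculus

theorem mainTheorem7 {A Ω : Type*}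
    [Ring A] [HopfAlgebra ℂ A] [StarRing A] [StarModule ℂ A] [HopfStarAlgebra A]
    [Ring Ω] [Algebra ℂ Ω] [StarAddMonoid Ω] [StarModule ℂ Ω]
    (h : A →ₗ[ℂ] ℂ) (hh : IsHaarIntegral h)
    (Γ : StarDifferentialCalculus A Ω) (N : ℕ)
    (hfin : FiniteDimensional ℂ Γ.inv)
    (hN : Γ.HasDimension N)
    (htop : Module.finrank ℂ (Γ.invForm N) = 1)
    (hclosed : ∀ k : ℕ, k + 1 = N → ∀ ω ∈ Γ.invForm k, Γ.d ω = 0)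
    (hnd : Γ.Nondegenerate N)
    (ip : InnerProductSpace.Core ℂ Ω)
    (hgr : Γ.IsGraded ip) (hli : Γ.IsLeftInvariant h ip)
    (θ : Ω) (hθ : Γ.IsVolumeElement N ip θ) :
    -- the integral of `θ` and the codifferential exist and are unique
    (∃! J : Ω →ₗ[ℂ] ℂ, Γ.IsIntegral h N θ J) ∧
    (∃! ds : Ω →ₗ[ℂ] Ω, IsAdjointFor ip Γ.d ds) ∧
    ∀ J : Ω →ₗ[ℂ] ℂ, Γ.IsIntegral h N θ J →
      -- the twist automorphism and the Hodge operator exist and are unique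
      (∃! σ : Ω ≃ₐ[ℂ] Ω, Γ.IsTwistAutomorphism J σ) ∧
      (∃! L : Ω →ₗ[ℂ] Ω, Γ.IsHodgeOperator N ip J L) ∧
      -- if `σ` is positive, the group `β` exists, is unique, and has the four properties
      ∀ σ : Ω ≃ₐ[ℂ] Ω, Γ.IsTwistAutomorphism J σ → (∀ ω : Ω, 0 ≤ ipForm ip (σ ω) ω) →
        (∃! β : ℂ → (Ω ≃ₐ[ℂ] Ω), IsExponentialOneParameterGroup β ∧ β Complex.I = σ) ∧
        ∀ (β : ℂ → (Ω ≃ₐ[ℂ] Ω)) (ds L : Ω →ₗ[ℂ] Ω),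
          IsExponentialOneParameterGroup β → β Complex.I = σ →
          IsAdjointFor ip Γ.d ds → Γ.IsHodgeOperator N ip J L →
          (∀ (t : ℝ) (ω : Ω), 0 ≤ ipForm ip (β (t * Complex.I) ω) ω) ∧
          (∀ (z : ℂ) (ω η : Ω), ipForm ip (β z ω) η = ipForm ip ω (β (-conj z) η)) ∧
          (∀ (z : ℂ) (ω : Ω), ds (β z ω) = β z (ds ω) ∧
            Γ.dirac ds (β z ω) = β z (Γ.dirac ds ω) ∧
            Γ.laplacian ds (β z ω) = β z (Γ.laplacian ds ω)) ∧
          (∀ (z : ℂ) (ω : Ω), L (β z ω) = β z (L ω)) := by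
  have H : Γ.IsOriented h N ip θ := ⟨hh, hfin, hN, htop, hclosed, hnd, hgr, hli, hθ⟩
  refine ⟨H.existsUnique_integral, ?_, fun J hJ => ⟨H.existsUnique_twistAutomorphism hJ,
    H.existsUnique_hodge hJ, fun σ hσ hpos => ?_⟩⟩
  · exact H.existsUnique_codifferential H.isIntegral_ipLeft
  have hspan := H.mem_span_eigenvectors hJ hσ hpos
  refine ⟨existsUnique_exponentialOneParameterGroup hspan (H.twist_star_twist hJ hσ),
    fun β ds L hβ hI hds hL => ?_⟩
  have hd : ∀ z ω, Γ.d (β z ω) = β z (Γ.d ω) :=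
    hβ.commute_of_commute hspan hI Γ.d fun ω => (hσ.comm_d ω).symm
  have hds' : ∀ z ω, ds (β z ω) = β z (ds ω) := hβ.adjoint_commute hspan hI hpos hds hd
  have hD : ∀ z ω, Γ.dirac ds (β z ω) = β z (Γ.dirac ds ω) := fun z ω => by
    simp only [StarDifferentialCalculus.dirac, LinearMap.add_apply, hd, hds', map_add]
  refine ⟨hβ.ipForm_apply_self_nonneg hspan hI hpos, hβ.ipForm_apply hspan hI hpos,
    fun z ω => ⟨hds' z ω, hD z ω, ?_⟩,
    hβ.commute_of_commute hspan hI L (H.hodge_twist hJ hσ hpos hL)⟩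
  simp only [StarDifferentialCalculus.laplacian, LinearMap.comp_apply, hD]
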